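/- Let $2^{\omega}$ be the space of infinite binary sequences with the uniform measure $\mu$, and $2^{<\omega}$ the set of finite binary strings. For $U\subseteq 2^{<\omega}$ let $[U]$ be the set of sequences having a prefix in $U$. For $A\in 2^{\omega}$, an \emph{$A$-c.e. open set} is a set $[U]$ with $U$ prefix-free and c.e. relative to $A$; it is \emph{bounded} if $\mu([U])<1$, and it is an \emph{$A$-Schnorr open set} if $\mu([U])$ is a real number computable relative to $A$. An \emph{$A$-Schnorr test} is a non-increasing sequence $(\mathcal U_n)_{n\in\mathbb N}$ of uniformly $A$-c.e. open sets with $\mu(\mathcal U_n)=2^{-n}$ for all $n$; $X\in 2^\omega$ is \emph{$A$-Schnorr random} if $X\notin\bigcap_n\mathcal U_n$ for every $A$-Schnorr test; $\mathrm{SR}^A$ is the class of these sequences. A \emph{martingale} is a function $d:2^{<\omega}\to\mathbb R^{\ge 0}$ with $d(\sigma)=\frac{d(\sigma 0)+d(\sigma 1)}2$ for all $\sigma$; it is \emph{normed} if $d$ equals $1$ at the empty string. A sequence $X$ is \emph{computably random} if $\limsup_n d(X\upharpoonright n)<\infty$ for every computable (real-valued) martingale $d$; $\mathrm{CR}$ is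 the class of these sequences. A \emph{winning open set} is a set $[U]$ where, for some normed martingale $d$ that is rational-valued and computable as a function into $\mathbb Q$, and some rational $q>1$, $U$ is the set of strings $\sigma$ with $d(\sigma)\ge q$ such that $d(\tau)<q$ for every proper prefix $\tau$ of $\sigma$. Finally, $\mathrm{Low}(\mathrm{CR},\mathrm{SR})$ is the set of $A\in 2^\omega$ with $\mathrm{CR}\subseteq\mathrm{SR}^A$. For every $A\in 2^\omega$ the following are equivalent: (i) $A\in\mathrm{Low}(\mathrm{CR},\mathrm{SR})$; (ii) every bounded $A$-Schnorr open set is contained in a winning open set. -/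

import Mathlib

open MeasureTheory Filter

namespace OpenCovers

/-! ### Cantor space -/

/-- Infinite binary sequences. -/
abbrev Cantor : Type := ℕ → Bool

/-- The prefix of `X` of length `n`. -/
def initSeg (X : Cantor) (n : ℕ) : List Bool := (List.range n).map X

/-- The cylinder generated by a string: all sequences with prefix `σ`. -/
def cyl (σ : List Bool) : Set Cantor := {X | initSeg X σ.length = σ}

/-- The open set generated by a set of strings. -/
def openSet (U : Set (List Bool)) : Set Cantor := ⋃ σ ∈ U, cyl σ

/-- No element of `U` is a proper prefix of another element of `U`. -/
def PrefixFree (U : Set (List Bool)) : Prop := ∀ σ ∈ U, ∀ τ ∈ U, σ <+: τ → σ = τ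

/-- The uniform measure on Cantor space: the product of fair coins. -/
noncomputable def lebesgue : Measure Cantor :=
  Measure.infinitePi fun _ : ℕ => (PMF.uniformOfFintype Bool).toMeasure

/-! ### Relative computability

`O` is a set of oracles; unrelativized notions are those with `O = ∅`. -/

/-- The oracle set consisting of (the characteristic function of) one sequence `A`. -/
def oracle (A : Cantor) : Set (ℕ →. ℕ) := {fun n => Part.some (A n).toNat}

/-- A set is c.e. relative to `O` if it is the domain of a function partial recursive in `O`. -/
def CEIn {α : Type} [Primcodable α] (O : Set (ℕ →. ℕ)) (S : Set α) : Prop :=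
  RecursiveIn O fun a => Part.assert (a ∈ S) fun _ => Part.some ()

/-- A rational-valued function is (exactly) computable relative to `O`: it is given as
`(p - m) / d` for natural-number-valued functions `p, m, d` computable in `O`, with `d` nonzero. -/
def RatComputableIn {α : Type} [Primcodable α] (O : Set (ℕ →. ℕ)) (f : α → ℚ) : Prop :=
  ∃ p m d : α → ℕ, ComputableIn O p ∧ ComputableIn O m ∧ ComputableIn O d ∧
    ∀ a, d a ≠ 0 ∧ f a = ((p a : ℚ) - (m a : ℚ)) / (d a : ℚ)

/-- A real-valued function is computable relative to `O`: rational approximations with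
precision `2⁻ⁿ` can be computed from the argument and `n`. -/
def RealFunComputableIn {α : Type} [Primcodable α] (O : Set (ℕ →. ℕ)) (f : α → ℝ) : Prop :=
  ∃ g : α × ℕ → ℚ, RatComputableIn O g ∧ ∀ a n, |(g (a, n) : ℝ) - f a| ≤ (2 : ℝ)⁻¹ ^ n

/-- A real number is computable relative to `O`. -/
def RealComputableIn (O : Set (ℕ →. ℕ)) (x : ℝ) : Prop :=
  RealFunComputableIn O fun _ : Unit => x

/-! ### Schnorr open sets, Schnorr tests, Schnorr randomness -/

/-- A set of sequences that is c.e. open relative to `O`: it is generated by a prefix-free set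
of strings that is c.e. in `O`. -/
def CEOpenIn (O : Set (ℕ →. ℕ)) (V : Set Cantor) : Prop :=
  ∃ U : Set (List Bool), PrefixFree U ∧ CEIn O U ∧ V = openSet U

/-- A c.e. open set whose measure is computable (both relative to `O`). -/
def SchnorrOpenIn (O : Set (ℕ →. ℕ)) (V : Set Cantor) : Prop :=
  CEOpenIn O V ∧ RealComputableIn O (lebesgue V).toReal

/-- Bounded: of measure smaller than one. -/
def Bounded (V : Set Cantor) : Prop := lebesgue V < 1

/-- A sequence of sets that are c.e. open relative to `O`, uniformly in the index. -/
def UniformlyCEOpenIn (O : Set (ℕ →. ℕ)) (T : ℕ → Set Cantor) : Prop :=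
  ∃ W : Set (ℕ × List Bool), CEIn O W ∧
    ∀ n, PrefixFree {σ | (n, σ) ∈ W} ∧ T n = openSet {σ | (n, σ) ∈ W}

/-- A Schnorr test relative to `O`: a non-increasing sequence of uniformly c.e. open sets,
the `n`-th one of measure exactly `2⁻ⁿ`. -/
def SchnorrTestIn (O : Set (ℕ →. ℕ)) (T : ℕ → Set Cantor) : Prop :=
  UniformlyCEOpenIn O T ∧ Antitone T ∧ ∀ n, lebesgue (T n) = (2 : ENNReal)⁻¹ ^ n

/-- `SR A` is the class of `A`-Schnorr random sequences: those passing all `A`-Schnorr tests. -/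
def SR (A : Cantor) : Set Cantor :=
  {X | ∀ T : ℕ → Set Cantor, SchnorrTestIn (oracle A) T → X ∉ ⋂ n, T n}

/-! ### Martingales, computable randomness, winning sets -/

/-- Martingales: nonnegative real functions on strings satisfying the fairness condition. -/
def IsMartingale (d : List Bool → ℝ) : Prop :=
  (∀ σ, 0 ≤ d σ) ∧ ∀ σ, d σ = (d (σ ++ [false]) + d (σ ++ [true])) / 2

/-- `d` succeeds on `X` if the limit superior of its capital along `X` is infinite. -/
def Succeeds (d : List Bool → ℝ) (X : Cantor) : Prop :=
  limsup (fun n => ((d (initSeg X n) : ℝ) : EReal)) atTop = ⊤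

/-- The class of computably random sequences: no computable (real-valued) martingale succeeds
on them. -/
def CR : Set Cantor :=
  {X | ∀ d : List Bool → ℝ, IsMartingale d → RealFunComputableIn ∅ d → ¬ Succeeds d X}

/-- The set of strings `σ` that are minimal with `d σ ≥ q` (no proper prefix has the property). -/
def minimalReaching (d : List Bool → ℚ) (q : ℚ) : Set (List Bool) :=
  {σ | q ≤ d σ ∧ ∀ τ, τ <+: σ → τ ≠ σ → ¬ q ≤ d τ}

/-- Winning sets of strings: the strings minimal with `d σ ≥ q`, for an exactly computable
(rational-valued) normed martingale `d` and a rational `q > 1`. -/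
def WinningSet (U : Set (List Bool)) : Prop :=
  ∃ (d : List Bool → ℚ) (q : ℚ), IsMartingale (fun σ => (d σ : ℝ)) ∧ d [] = 1 ∧
    RatComputableIn ∅ d ∧ 1 < q ∧ U = minimalReaching d q

/-- Winning open sets: the open sets generated by winning sets of strings
(these are prefix-free and computable, so the generated set is c.e. open). -/
def WinningOpen (V : Set Cantor) : Prop := ∃ U, WinningSet U ∧ V = openSet U

/-! ### Lowness for pairs -/

/-- `LowPair R S`, for a class `R` and a class `S` that can be relativized, is the set of
oracles `A` with `R ⊆ S^A`. -/
def LowPair (R : Set Cantor) (S : Cantor → Set Cantor) : Set Cantor := {A | R ⊆ S A}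

end OpenCovers

/-! Covers imply lowness. Let `X` lie in every `T n` of an `A`-Schnorr test. From each string
generating `T (2 * i + 2)` delete the first `i` letters; the weights of the shortened strings add up
to `∑ 2 ^ i * 2⁻¹ ^ (2 * i + 2) = 1 / 2`, and their cylinders contain every tail of `X`. Padded to
measure exactly `1 / 2`, they form a bounded `A`-Schnorr open set (`tsum_weight_drop`,
`exists_prefixFree_half`). If a martingale wins `q` on a cover of that set, then it can be restarted
along `X` each time it reaches `q`, since the remaining tail is again covered; its capital is
multiplied by at least `q` each time, so `X` is not computably random (`exists_restart`).

Lowness implies covers, by contraposition. If no winning open set covers `V`, then every positive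
computable rational martingale starting below `q` stays below `q` along some element of `V`
(`Escapes`). Since such a martingale can be played again from any string reached, the powers of the
generating set inherit the property (`Escapes.concatPow`). A high power has measure below `1 / 2`
and can be padded to some `[U]` of measure `1 / 2`; the sets `[Uⁿ]` then have measure `2⁻ⁿ` and form
an `A`-Schnorr test. A finite extension argument finds `X` in all of them: step `n` adds a small
positive multiple of the `n`-th computable martingale to a mixture kept below `2`, and appends an
element of `U` along which the mixture stays below `2` (`Escapes.exists_mem_CR`). Every computable
martingale is thus bounded on `X`, so `X` is computably random but not `A`-Schnorr random.

Both directions use the padding. It fills a c.e. open set from the left in lexicographic order; the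
fill is c.e. because "the measure is still below `1 / 2`" has finite certificates as soon as the
total weight is approximable from above. Relative enumerability is handled throughout by the normal
form `CE`, which is equivalent to `CEIn`. -/

namespace OpenCovers

/-! ### Initial segments and the normal form of relative enumerability -/

section Basic
variable {α β γ : Type} [Primcodable α] [Primcodable β] [Primcodable γ]

@[simp] theorem length_initSeg (X : Cantor) (n : ℕ) : (initSeg X n).length = n := by
  simp [initSeg]

@[simp] theorem initSeg_zero (X : Cantor) : initSeg X 0 = [] := rfl

theorem initSeg_succ (X : Cantor) (n : ℕ) : initSeg X (n + 1) = initSeg X n ++ [X n] := by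
  simp [initSeg, List.range_succ]

theorem getElem?_initSeg (X : Cantor) (n i : ℕ) :
    (initSeg X n)[i]? = if i < n then some (X i) else none := by
  unfold initSeg
  rw [List.getElem?_map]
  split_ifs with h
  · simp [h]
  · simp [not_lt.1 h]

theorem take_initSeg (X : Cantor) {m n : ℕ} (h : m ≤ n) :
    (initSeg X n).take m = initSeg X m := by
  simp [initSeg, ← List.map_take, List.take_range, h]

theorem initSeg_prefix (X : Cantor) {m n : ℕ} (h : m ≤ n) : initSeg X m <+: initSeg X n := by
  rw [← take_initSeg X h]
  exact List.take_prefix _ _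

theorem prefix_initSeg_iff {X : Cantor} {n : ℕ} {σ : List Bool} :
    σ <+: initSeg X n ↔ σ.length ≤ n ∧ initSeg X σ.length = σ := by
  constructor
  · intro h
    have hl : σ.length ≤ n := by simpa using h.length_le
    exact ⟨hl, by rw [← take_initSeg X hl, ← List.prefix_iff_eq_take.1 h]⟩
  · rintro ⟨hl, h⟩
    rw [← h]
    exact initSeg_prefix X hl

/-- `S` is recursively enumerable in `A`, in normal form: membership of `a` in `S` is witnessed by
a finite prefix of `A` through a primitive recursive relation, monotone in the prefix. -/
def CE (A : Cantor) (S : α → Prop) : Prop :=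
  ∃ R : α → List Bool → Prop, PrimrecRel R ∧ (∀ a s t, s <+: t → R a s → R a t) ∧
    ∀ a, S a ↔ ∃ n, R a (initSeg A n)

theorem primrecRel_exists_lt {R : ℕ → α → Prop} (hR : PrimrecRel R) :
    PrimrecRel fun (n : ℕ) (a : α) => ∃ k < n, R k a :=
  PrimrecPred.of_eq (PrimrecRel.comp (f := fun p : ℕ × α => List.range p.1) (g := Prod.snd)
    hR.exists_mem_list (Primrec.list_range.comp Primrec.fst) Primrec.snd) fun p => by simp

theorem primrecRel_exists_take {p : α → List Bool → Prop} (hp : PrimrecRel p) :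
    PrimrecRel fun (a : α) (s : List Bool) => ∃ k < s.length + 1, p a (s.take k) := by
  have h1 : PrimrecRel fun (k : ℕ) (y : α × List Bool) => p y.1 (y.2.take k) :=
    PrimrecRel.comp hp (Primrec.fst.comp Primrec.snd)
      (Primrec.list_take.comp Primrec.fst (Primrec.snd.comp Primrec.snd))
  exact PrimrecRel.comp (primrecRel_exists_lt h1)
    (Primrec.succ.comp (Primrec.list_length.comp Primrec.snd)) Primrec.id

/-- Monotonicity in the prefix comes for free: replace `R` by a search through all shorter prefixes.
-/
theorem CE.of_exists_prefix {A : Cantor} {R : α → List Bool → Prop} {S : α → Prop}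
    (hR : PrimrecRel R) (hS : ∀ a, S a ↔ ∃ n, R a (initSeg A n)) : CE A S := by
  refine ⟨fun a s => ∃ k < s.length + 1, R a (s.take k), primrecRel_exists_take hR, ?_, ?_⟩
  · rintro a s t ⟨u, rfl⟩ ⟨k, hk, h⟩
    refine ⟨k, by simp; omega, ?_⟩
    rwa [List.take_append_of_le_length (by omega)]
  · intro a
    rw [hS]
    constructor
    · rintro ⟨n, h⟩
      exact ⟨n, n, by simp, by rwa [take_initSeg A le_rfl]⟩
    · rintro ⟨n, k, hk, h⟩
      rw [take_initSeg A (by simpa [Nat.lt_succ_iff] using hk)] at h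
      exact ⟨k, h⟩

variable {A : Cantor}

theorem CE.of_eq {S T : α → Prop} (h : CE A S) (H : ∀ a, S a ↔ T a) : CE A T :=
  (funext fun a => propext (H a) : S = T) ▸ h

theorem CE.of_primrec {S : α → Prop} (h : PrimrecPred S) : CE A S :=
  ⟨fun a _ => S a, h.comp Primrec.fst, fun _ _ _ _ h => h, fun _ => by simp⟩

theorem CE.and {S T : α → Prop} (hS : CE A S) (hT : CE A T) : CE A fun a => S a ∧ T a := by
  obtain ⟨R, hR, mR, hS⟩ := hS
  obtain ⟨Q, hQ, mQ, hT⟩ := hT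
  refine ⟨fun a s => R a s ∧ Q a s, hR.and hQ, fun a s t h1 h => ⟨mR a s t h1 h.1, mQ a s t h1 h.2⟩,
    fun a => ?_⟩
  simp only [hS, hT]
  constructor
  · rintro ⟨⟨m, hm⟩, n, hn⟩
    exact ⟨max m n, mR _ _ _ (initSeg_prefix A (le_max_left _ _)) hm,
      mQ _ _ _ (initSeg_prefix A (le_max_right _ _)) hn⟩
  · rintro ⟨n, h1, h2⟩
    exact ⟨⟨n, h1⟩, n, h2⟩

theorem CE.or {S T : α → Prop} (hS : CE A S) (hT : CE A T) : CE A fun a => S a ∨ T a := by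
  obtain ⟨R, hR, mR, hS⟩ := hS
  obtain ⟨Q, hQ, mQ, hT⟩ := hT
  refine ⟨fun a s => R a s ∨ Q a s, hR.or hQ,
    fun a s t h1 h => h.imp (mR a s t h1) (mQ a s t h1), fun a => ?_⟩
  simp only [hS, hT, exists_or]

theorem CE.comp {S : β → Prop} (hS : CE A S) {f : α → β} (hf : Primrec f) :
    CE A fun a => S (f a) := by
  obtain ⟨R, hR, mR, hS⟩ := hS
  exact ⟨fun a s => R (f a) s, PrimrecRel.comp hR (hf.comp Primrec.fst) Primrec.snd,
    fun a => mR (f a), fun a => hS (f a)⟩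

/-- The length of the oracle prefix also bounds the code of the witness, which keeps the relation
primitive recursive. -/
theorem CE.exists {S : α → β → Prop} (hS : CE A fun p : α × β => S p.1 p.2) :
    CE A fun a => ∃ b, S a b := by
  obtain ⟨R, hR, mR, hS⟩ := hS
  have h1 : PrimrecRel fun (k : ℕ) (y : α × List Bool) =>
      ∃ b ∈ (Encodable.decode (α := β) k).toList, R (y.1, b) y.2 := by
    have h2 : PrimrecRel fun (b : β) (y : α × List Bool) => R (y.1, b) y.2 :=
      PrimrecRel.comp hR (Primrec.pair (Primrec.fst.comp Primrec.snd) Primrec.fst)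
        (Primrec.snd.comp Primrec.snd)
    exact PrimrecRel.comp h2.exists_mem_list
      (Primrec.optionToList.comp (Primrec.decode.comp Primrec.fst)) Primrec.snd
  have h3 := primrecRel_exists_lt h1
  refine ⟨fun a s => ∃ k < s.length, ∃ b ∈ (Encodable.decode (α := β) k).toList, R (a, b) s,
    PrimrecRel.comp h3 (Primrec.list_length.comp Primrec.snd) Primrec.id, ?_, ?_⟩
  · rintro a s t h ⟨k, hk, b, hb, hr⟩
    exact ⟨k, hk.trans_le h.length_le, b, hb, mR _ _ _ h hr⟩
  · intro a
    constructor
    · rintro ⟨b, hb⟩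
      obtain ⟨n, hn⟩ := (hS (a, b)).1 hb
      refine ⟨max n (Encodable.encode b + 1), Encodable.encode b, by simp, b, by simp,
        mR _ _ _ (initSeg_prefix A (le_max_left _ _)) hn⟩
    · rintro ⟨n, k, -, b, -, hr⟩
      exact ⟨b, (hS (a, b)).2 ⟨n, hr⟩⟩

/-- Finitely many witnessing prefixes of `A` have a longest one, and by monotonicity it serves for
all. -/
theorem CE.forall_mem {S : α → β → Prop} (hS : CE A fun p : α × β => S p.1 p.2) :
    CE A fun p : α × List β => ∀ b ∈ p.2, S p.1 b := by
  obtain ⟨R, hR, mR, hS⟩ := hS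
  have h2 : PrimrecRel fun (b : β) (y : α × List Bool) => R (y.1, b) y.2 :=
    PrimrecRel.comp hR (Primrec.pair (Primrec.fst.comp Primrec.snd) Primrec.fst)
      (Primrec.snd.comp Primrec.snd)
  refine ⟨fun p s => ∀ b ∈ p.2, R (p.1, b) s, PrimrecRel.comp h2.forall_mem_list
    (Primrec.snd.comp Primrec.fst) (Primrec.pair (Primrec.fst.comp Primrec.fst) Primrec.snd),
    fun p s t h hr b hb => mR _ _ _ h (hr b hb), ?_⟩
  rintro ⟨a, l⟩
  dsimp only
  constructor
  · intro h
    induction l with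
    | nil => exact ⟨0, by simp⟩
    | cons b l ih =>
      obtain ⟨m, hm⟩ := (hS (a, b)).1 (h b (by simp))
      obtain ⟨n, hn⟩ := ih fun b' hb' => h b' (by simp [hb'])
      refine ⟨max m n, fun b' hb' => ?_⟩
      rcases List.mem_cons.1 hb' with rfl | hb'
      · exact mR _ _ _ (initSeg_prefix A (le_max_left _ _)) hm
      · exact mR _ _ _ (initSeg_prefix A (le_max_right _ _)) (hn b' hb')
  · rintro ⟨n, hn⟩ b hb
    exact (hS (a, b)).2 ⟨n, hn b hb⟩

theorem CE.forall_lt {S : α → ℕ → Prop} (hS : CE A fun p : α × ℕ => S p.1 p.2) :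
    CE A fun p : α × ℕ => ∀ b < p.2, S p.1 b :=
  (hS.forall_mem.comp (Primrec.pair Primrec.fst (Primrec.list_range.comp Primrec.snd))).of_eq
    fun p => by simp

theorem CE.query : CE A fun p : ℕ × Bool => A p.1 = p.2 := by
  refine ⟨fun p s => s[p.1]? = some p.2, PrimrecRel.comp Primrec.eq
    (Primrec.list_getElem?.comp Primrec.snd (Primrec.fst.comp Primrec.fst))
    (Primrec.option_some.comp (Primrec.snd.comp Primrec.fst)), ?_, ?_⟩
  · rintro ⟨n, b⟩ s t ⟨u, rfl⟩ h
    dsimp only at h ⊢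
    rw [List.getElem?_append_left, h]
    by_contra hn
    rw [List.getElem?_eq_none (not_lt.1 hn)] at h
    cases h
  · rintro ⟨n, b⟩
    simp only [getElem?_initSeg]
    constructor
    · intro h
      exact ⟨n + 1, by simp [h]⟩
    · rintro ⟨m, h⟩
      split_ifs at h with h1
      exact Option.some.inj h

end Basic

/-! ### From oracle computations to the normal form -/

section Recursive
variable {α β γ σ : Type} [Primcodable α] [Primcodable β] [Primcodable γ] [Primcodable σ]
variable {A : Cantor}

/-- A primitive recursion is replaced by the list of its intermediate values, so that its graph
becomes an existential statement over lists. -/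
theorem mem_natRec_iff {f : Part ℕ} {h : ℕ → ℕ → Part ℕ} {n b : ℕ} :
    b ∈ (n.rec f fun y IH => IH.bind fun i => h y i : Part ℕ) ↔
      ∃ l : List ℕ, l.length = n + 1 ∧ l.getD 0 0 ∈ f ∧ l.getD n 0 = b ∧
        ∀ k < n, l.getD (k + 1) 0 ∈ h k (l.getD k 0) := by
  induction n generalizing b with
  | zero =>
    constructor
    · intro hb
      exact ⟨[b], by simpa using hb⟩
    · rintro ⟨l, -, h1, rfl, -⟩
      exact h1
  | succ n ih =>
    simp only [Part.mem_bind_iff]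
    constructor
    · rintro ⟨i, hi, hb⟩
      obtain ⟨l, hl, h0, hn, hk⟩ := ih.1 hi
      have key : ∀ k, k < n + 1 → (l ++ [b]).getD k 0 = l.getD k 0 := fun k hk => by
        simp [List.getD, List.getElem?_append_left (hl ▸ hk)]
      have last : (l ++ [b]).getD (n + 1) 0 = b := by
        simp [List.getD, ← hl]
      refine ⟨l ++ [b], by simp [hl], by rwa [key 0 (by omega)], last, fun k hk' => ?_⟩
      rcases Nat.lt_succ_iff_lt_or_eq.1 hk' with h1 | rfl
      · rw [key _ (by omega), key _ (by omega)]
        exact hk k h1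
      · rw [last, key _ (by omega), hn]
        exact hb
    · rintro ⟨l, hl, h0, rfl, hk⟩
      refine ⟨l.getD n 0, ih.2 ⟨l.take (n + 1), by simp [hl], ?_, ?_, fun k hk' => ?_⟩,
        hk n (by omega)⟩
      · simpa [List.getD] using h0
      · simp [List.getD, List.getElem?_take]
      · have := hk k (by omega)
        simpa [List.getD, List.getElem?_take, hk', hk'.trans (Nat.lt_succ_self n)] using this

theorem primrec_natPair {f g : α → ℕ} (hf : Primrec f) (hg : Primrec g) :
    Primrec fun a => Nat.pair (f a) (g a) := Primrec₂.natPair.comp hf hg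

theorem primrec_unpair_fst : Primrec fun n : ℕ => n.unpair.1 := Primrec.fst.comp Primrec.unpair

theorem primrec_unpair_snd : Primrec fun n : ℕ => n.unpair.2 := Primrec.snd.comp Primrec.unpair

open Primrec in
-- The use principle: a halting computation reads only finitely many bits of `A`. The proof is by
-- induction on the construction of `f`.
theorem CE.graph_nat {f : ℕ →. ℕ} (hf : Nat.RecursiveIn (oracle A) f) :
    CE A fun p : ℕ × ℕ => p.2 ∈ f p.1 := by
  induction hf with
  | zero =>
    refine (CE.of_primrec (PrimrecRel.comp Primrec.eq snd (Primrec.const 0))).of_eq fun p => ?_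
    exact Part.mem_some_iff.symm
  | succ =>
    refine (CE.of_primrec (PrimrecRel.comp Primrec.eq snd (succ.comp fst))).of_eq fun p => ?_
    exact Part.mem_some_iff.symm
  | left =>
    refine (CE.of_primrec (PrimrecRel.comp Primrec.eq snd
      (primrec_unpair_fst.comp fst))).of_eq fun p => ?_
    exact Part.mem_some_iff.symm
  | right =>
    refine (CE.of_primrec (PrimrecRel.comp Primrec.eq snd
      (primrec_unpair_snd.comp fst))).of_eq fun p => ?_
    exact Part.mem_some_iff.symm
  | oracle g hg =>
    obtain rfl : g = fun n => Part.some (A n).toNat := hg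
    have h1 : CE A fun p : ℕ × ℕ => ∃ b : Bool, A p.1 = b ∧ p.2 = b.toNat :=
      CE.exists (S := fun (p : ℕ × ℕ) b => A p.1 = b ∧ p.2 = b.toNat)
        ((CE.query.comp (pair (fst.comp fst) snd)).and (CE.of_primrec
          (PrimrecRel.comp Primrec.eq (snd.comp fst) ((dom_bool Bool.toNat).comp snd))))
    refine h1.of_eq fun p => ?_
    simp
  | @pair f h _ _ ihf ihh =>
    have h1 : CE A fun p : ℕ × ℕ => p.2.unpair.1 ∈ f p.1 ∧ p.2.unpair.2 ∈ h p.1 :=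
      (ihf.comp (pair fst (primrec_unpair_fst.comp snd))).and
        (ihh.comp (pair fst (primrec_unpair_snd.comp snd)))
    refine h1.of_eq fun p => ?_
    simp only [Seq.seq, Part.map_eq_map, Part.mem_bind_iff, Part.mem_map_iff]
    constructor
    · rintro ⟨ha, hb⟩
      exact ⟨_, ⟨_, ha, rfl⟩, _, hb, by simp⟩
    · rintro ⟨_, ⟨a, ha, rfl⟩, b, hb, h⟩
      rw [← h]
      simpa using ⟨ha, hb⟩
  | @comp f h _ _ ihf ihh =>
    have h1 : CE A fun p : ℕ × ℕ => ∃ c, c ∈ h p.1 ∧ p.2 ∈ f c :=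
      CE.exists (S := fun (p : ℕ × ℕ) c => c ∈ h p.1 ∧ p.2 ∈ f c)
        ((ihh.comp (pair (fst.comp fst) snd)).and (ihf.comp (pair snd (snd.comp fst))))
    refine h1.of_eq fun p => ?_
    exact (Part.mem_bind_iff (f := h p.1) (g := f)).symm
  | @prec f h _ _ ihf ihh =>
    have getD0 : ∀ {δ : Type} [Primcodable δ] {u : δ → List ℕ} {v : δ → ℕ}, Primrec u → Primrec v →
        Primrec fun d => (u d).getD (v d) 0 := fun hu hv => (list_getD 0).comp hu hv
    have h1 : CE A fun p : ℕ × ℕ => ∃ l : List ℕ, (l.length = p.1.unpair.2 + 1 ∧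
        l.getD p.1.unpair.2 0 = p.2) ∧ l.getD 0 0 ∈ f p.1.unpair.1 ∧
        ∀ k < p.1.unpair.2, l.getD (k + 1) 0 ∈
          h (Nat.pair p.1.unpair.1 (Nat.pair k (l.getD k 0))) := by
      refine CE.exists (S := fun (p : ℕ × ℕ) (l : List ℕ) => (l.length = p.1.unpair.2 + 1 ∧
        l.getD p.1.unpair.2 0 = p.2) ∧ l.getD 0 0 ∈ f p.1.unpair.1 ∧
        ∀ k < p.1.unpair.2, l.getD (k + 1) 0 ∈
          h (Nat.pair p.1.unpair.1 (Nat.pair k (l.getD k 0)))) ?_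
      have hu : Primrec fun p : (ℕ × ℕ) × List ℕ => p.1.1.unpair.1 :=
        primrec_unpair_fst.comp (fst.comp fst)
      have hv : Primrec fun p : (ℕ × ℕ) × List ℕ => p.1.1.unpair.2 :=
        primrec_unpair_snd.comp (fst.comp fst)
      refine ((CE.of_primrec ?_).and ?_).and ?_ |>.of_eq fun p => and_assoc
      · exact (PrimrecRel.comp Primrec.eq (list_length.comp snd) (succ.comp hv)).and
          (PrimrecRel.comp Primrec.eq (getD0 snd hv) (snd.comp fst))
      · exact ihf.comp (pair hu (getD0 snd (Primrec.const 0)))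
      · have h2 := ihh.comp (f := fun q : (ℕ × List ℕ) × ℕ =>
            (Nat.pair q.1.1 (Nat.pair q.2 (q.1.2.getD q.2 0)), q.1.2.getD (q.2 + 1) 0))
          (pair (primrec_natPair (fst.comp fst)
            (primrec_natPair snd (getD0 (snd.comp fst) snd)))
            (getD0 (snd.comp fst) (succ.comp snd)))
        have h3 := CE.forall_lt (S := fun (q : ℕ × List ℕ) (k : ℕ) => q.2.getD (k + 1) 0 ∈
          h (Nat.pair q.1 (Nat.pair k (q.2.getD k 0)))) h2
        exact h3.comp (pair (pair hu snd) hv)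
    refine h1.of_eq fun p => ?_
    simp only [Part.bind_eq_bind]
    refine Iff.trans ?_ (mem_natRec_iff (f := f p.1.unpair.1)
      (h := fun k i => h (Nat.pair p.1.unpair.1 (Nat.pair k i))) (n := p.1.unpair.2)
      (b := p.2)).symm
    exact exists_congr fun l => by tauto
  | @rfind f _ ihf =>
    -- A minimization returns `m` when `f` takes the value zero at `m` and is defined and nonzero at
    -- every smaller argument.
    have h1 : CE A fun p : ℕ × ℕ => ∃ k, k ≠ 0 ∧ k ∈ f (Nat.pair p.1 p.2) :=
      CE.exists (S := fun (p : ℕ × ℕ) k => k ≠ 0 ∧ k ∈ f (Nat.pair p.1 p.2))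
        ((CE.of_primrec (PrimrecRel.comp Primrec.eq snd (Primrec.const 0)).not).and
          (ihf.comp (pair (primrec_natPair (fst.comp fst) (snd.comp fst)) snd)))
    have h2 := CE.forall_lt (S := fun (a m : ℕ) => ∃ k, k ≠ 0 ∧ k ∈ f (Nat.pair a m)) h1
    refine ((ihf.comp (pair (primrec_natPair fst snd) (Primrec.const 0))).and h2).of_eq fun p => ?_
    refine Iff.trans ?_ (Nat.mem_rfind (p := fun n => (fun m => decide (m = 0)) <$>
      (show Part ℕ from f (Nat.pair p.1 n)))).symm
    refine and_congr ?_ ⟨fun h m hm => ?_, fun h m hm => ?_⟩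
    · simp [Part.map_eq_map, Part.mem_map_iff]
    · obtain ⟨k, hk, hf⟩ := h m hm
      exact (Part.mem_map_iff _).2 ⟨k, hf, by simpa using hk⟩
    · obtain ⟨k, hf, hk⟩ := (Part.mem_map_iff _).1 (h hm)
      exact ⟨k, by simpa using hk, hf⟩

theorem CE.graph {f : α →. σ} (hf : RecursiveIn (oracle A) f) :
    CE A fun p : α × σ => p.2 ∈ f p.1 := by
  refine ((CE.graph_nat hf).comp (Primrec.pair (Primrec.encode.comp Primrec.fst)
    (Primrec.encode.comp Primrec.snd))).of_eq fun p => ?_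
  simp [Part.mem_map_iff]

theorem CE.of_CEIn {S : Set α} (h : CEIn (oracle A) S) : CE A fun a => a ∈ S := by
  refine ((CE.graph h).comp (Primrec.pair Primrec.id (Primrec.const ()))).of_eq fun a => ?_
  simp [Part.mem_assert_iff]

end Recursive
-- From the normal form back to oracle computations
section Search
variable {α β γ σ : Type} [Primcodable α] [Primcodable β] [Primcodable γ] [Primcodable σ]
variable {A : Cantor}

theorem recursiveIn_initSeg (A : Cantor) :
    Nat.RecursiveIn (oracle A) fun n => Part.some (Encodable.encode (initSeg A n)) := by
  have hA : Nat.RecursiveIn (oracle A) fun n => Part.some (A n).toNat :=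
    Nat.RecursiveIn.oracle _ rfl
  let G : ℕ → ℕ := fun w => Encodable.encode
    (((Encodable.decode (α := List Bool) w.unpair.1.unpair.2.unpair.2).getD []) ++
      [decide (w.unpair.2 = 1)])
  have hG : Nat.Primrec G := by
    refine Primrec.nat_iff.1 (Primrec.encode.comp (Primrec.list_concat.comp
      (Primrec.option_getD.comp (Primrec.decode.comp ?_) (Primrec.const []))
      (PrimrecPred.decide ?_)))
    · exact primrec_unpair_snd.comp (primrec_unpair_snd.comp primrec_unpair_fst)
    · exact PrimrecRel.comp Primrec.eq primrec_unpair_snd (Primrec.const 1)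
  have hid : Nat.RecursiveIn (oracle A) fun n => Part.some n := Nat.Primrec.id.recursiveIn
  have hstep := (hG.recursiveIn (O := oracle A)).comp (hid.pair
    (hA.comp ((Nat.RecursiveIn.left (O := oracle A)).comp Nat.RecursiveIn.right)))
  have hinit := (Nat.Primrec.const (Encodable.encode ([] : List Bool))).recursiveIn (O := oracle A)
  -- The recursion scheme expects a parameter; the constant `0` is a dummy.
  have hin : Nat.RecursiveIn (oracle A) fun n => Part.some (Nat.pair 0 n) :=
    (Primrec.nat_iff.1 (primrec_natPair (Primrec.const 0) Primrec.id)).recursiveIn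
  refine ((hinit.prec hstep).comp hin).of_eq fun n => ?_
  simp only [Part.bind_eq_bind, Part.bind_some, Nat.unpair_pair]
  induction n with
  | zero => rfl
  | succ n ih =>
    simp only [] at ih ⊢
    rw [ih]
    simp [Seq.seq, G, initSeg_succ]

/-- An unbounded search over pairs of a prefix length and a candidate value. Whichever pair is found
first, its value is correct because `f` is single-valued. -/
theorem recursiveIn_nat_of_graph {f : ℕ →. ℕ} (hf : CE A fun p : ℕ × ℕ => p.2 ∈ f p.1) :
    Nat.RecursiveIn (oracle A) f := by
  classical
  obtain ⟨R, hR, -, hS⟩ := hf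
  let Q : ℕ → Prop := fun w => R (w.unpair.1.unpair.1, w.unpair.1.unpair.2.unpair.2)
    ((Encodable.decode (α := List Bool) w.unpair.2).getD [])
  have hQ : PrimrecPred Q := by
    refine PrimrecRel.comp hR (Primrec.pair ?_ ?_)
      (Primrec.option_getD.comp (Primrec.decode.comp primrec_unpair_snd) (Primrec.const []))
    · exact primrec_unpair_fst.comp primrec_unpair_fst
    · exact primrec_unpair_snd.comp (primrec_unpair_snd.comp primrec_unpair_fst)
  have hT : Nat.RecursiveIn (oracle A) fun w => Part.some (if Q w then 0 else 1) :=
    (Primrec.nat_iff.1 (Primrec.ite hQ (Primrec.const 0) (Primrec.const 1))).recursiveIn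
  have hid : Nat.RecursiveIn (oracle A) fun n => Part.some n := Nat.Primrec.id.recursiveIn
  have hin := hid.pair ((recursiveIn_initSeg A).comp
    ((Nat.RecursiveIn.left (O := oracle A)).comp Nat.RecursiveIn.right))
  have hout : Nat.RecursiveIn (oracle A) fun w => Part.some w.unpair.2 := Nat.RecursiveIn.right
  refine (hout.comp (hT.comp hin).rfind).of_eq fun n => ?_
  have hfun : (fun k => (fun m => decide (m = 0)) <$>
      ((Nat.pair <$> Part.some (Nat.pair n k) <*>
        (((Part.some (Nat.pair n k).unpair.2 >>= fun n => Part.some n.unpair.1) >>=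
          fun n => Part.some (Encodable.encode (initSeg A n))))) >>=
        fun w => Part.some (if Q w then 0 else 1))) =
      ((fun k => decide (R (n, k.unpair.2) (initSeg A k.unpair.1)) : ℕ → Bool) : ℕ →. Bool) := by
    funext k
    simp [Seq.seq, Q]
  refine Part.ext fun b => ?_
  refine (Part.mem_bind_iff).trans ?_
  erw [hfun]
  constructor
  · rintro ⟨k, hk, hb⟩
    obtain rfl := Part.mem_some_iff.1 hb
    have h1 := Nat.rfind_spec hk
    exact (hS (n, k.unpair.2)).2 ⟨k.unpair.1, of_decide_eq_true (Part.mem_some_iff.1 h1).symm⟩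
  · intro hb
    obtain ⟨N, hN⟩ := (hS (n, b)).1 hb
    obtain ⟨k, hk, -⟩ := Nat.rfind_min'
      (p := fun k => decide (R (n, k.unpair.2) (initSeg A k.unpair.1))) (m := Nat.pair N b)
      (by simpa using hN)
    have h1 := of_decide_eq_true (Part.mem_some_iff.1 (Nat.rfind_spec hk)).symm
    have h2 : k.unpair.2 ∈ f n := (hS (n, k.unpair.2)).2 ⟨_, h1⟩
    exact ⟨k, hk, Part.mem_some_iff.2 (Part.mem_unique hb h2)⟩

theorem recursiveIn_of_graph {f : α →. σ} (hf : CE A fun p : α × σ => p.2 ∈ f p.1) :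
    RecursiveIn (oracle A) f := by
  refine recursiveIn_nat_of_graph ?_
  have h1 : CE A fun p : ℕ × ℕ => ∃ q : α × σ, (Encodable.decode p.1 = some q.1 ∧
      Encodable.encode q.2 = p.2) ∧ q.2 ∈ f q.1 :=
    CE.exists (S := fun (p : ℕ × ℕ) (q : α × σ) => (Encodable.decode p.1 = some q.1 ∧
      Encodable.encode q.2 = p.2) ∧ q.2 ∈ f q.1) <|
    (CE.of_primrec <| (PrimrecRel.comp Primrec.eq
      (Primrec.decode.comp (Primrec.fst.comp Primrec.fst))
      (Primrec.option_some.comp (Primrec.fst.comp Primrec.snd))).and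
      (PrimrecRel.comp Primrec.eq
      (Primrec.encode.comp (Primrec.snd.comp Primrec.snd)) (Primrec.snd.comp Primrec.fst))).and
      (hf.comp Primrec.snd)
  refine h1.of_eq fun p => ?_
  simp only [Part.mem_bind_iff, Part.mem_map_iff, Part.mem_coe, Option.mem_def]
  constructor
  · rintro ⟨⟨a, b⟩, ⟨h1, h2⟩, h3⟩
    exact ⟨a, h1, b, h3, h2⟩
  · rintro ⟨a, h1, b, h3, h2⟩
    exact ⟨⟨a, b⟩, ⟨h1, h2⟩, h3⟩

theorem CE.cein {S : Set α} (h : CE A fun a => a ∈ S) : CEIn (oracle A) S := by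
  refine recursiveIn_of_graph ((h.comp Primrec.fst).of_eq fun p => ?_)
  simp [Part.mem_assert_iff]

end Search

/-! ### Prefix-free generators -/

section PrefixFree
variable {A : Cantor}

theorem mem_openSet {U : Set (List Bool)} {X : Cantor} :
    X ∈ openSet U ↔ ∃ n, initSeg X n ∈ U := by
  simp only [openSet, Set.mem_iUnion, cyl, Set.mem_ofPred_eq, exists_prop]
  constructor
  · rintro ⟨σ, h, h1⟩
    exact ⟨σ.length, by rwa [h1]⟩
  · rintro ⟨n, h⟩
    exact ⟨_, h, by simp⟩

/-- Every open set generated by a set c.e. in `A` is generated by a prefix-free one. -/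
theorem CE.exists_prefixFree {D : List Bool → Prop} (hD : CE A D) :
    ∃ U : Set (List Bool), PrefixFree U ∧ CE A (fun σ => σ ∈ U) ∧
      openSet U = openSet {σ | D σ} := by
  obtain ⟨R, hR, mR, hS⟩ := hD
  let Q : List Bool → List Bool → Prop := fun τ s => ∃ i < τ.length + 1, R (τ.take i) s
  have hQ : PrimrecRel Q := by
    have h1 : PrimrecRel fun (i : ℕ) (p : List Bool × List Bool) => R (p.1.take i) p.2 :=
      PrimrecRel.comp hR (Primrec.list_take.comp Primrec.fst (Primrec.fst.comp Primrec.snd))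
        (Primrec.snd.comp Primrec.snd)
    exact PrimrecRel.comp (f := fun p : List Bool × List Bool => p.1.length + 1) (g := id)
      (primrecRel_exists_lt h1) (Primrec.succ.comp (Primrec.list_length.comp Primrec.fst)) Primrec.id
  have mQ : ∀ σ τ s t : List Bool, σ <+: τ → s <+: t → Q σ s → Q τ t := by
    rintro σ τ s t ⟨u, rfl⟩ h ⟨i, hi, hr⟩
    refine ⟨i, by simp; omega, ?_⟩
    rw [List.take_append_of_le_length (by omega)]
    exact mR _ _ _ h hr
  -- Delayed enumeration: `τ` counts once some prefix of it has been enumerated using `τ.length`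
  -- bits of `A`. This is decidable in `A` and closed under extension, so its minimal strings form a
  -- prefix-free c.e. set that generates the same open set.
  let P : List Bool → Prop := fun τ => Q τ (initSeg A τ.length)
  have mP : ∀ σ τ, σ <+: τ → P σ → P τ := fun σ τ h =>
    mQ _ _ _ _ h (initSeg_prefix A h.length_le)
  let U : Set (List Bool) := {τ | P τ ∧ ∀ l < τ.length, ¬ P (τ.take l)}
  refine ⟨U, ?_, ?_, ?_⟩
  · rintro σ ⟨hσ, -⟩ τ ⟨-, hτ⟩ h
    by_contra hne
    have hl : σ.length < τ.length :=
      lt_of_le_of_ne h.length_le fun he => hne (h.eq_of_length he)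
    exact hτ _ hl (by rwa [← List.prefix_iff_eq_take.1 h])
  · have h1 : PrimrecRel fun (τ s : List Bool) => s.length = τ.length ∧ Q τ s ∧
        ∀ l ∈ List.range τ.length, ¬ Q (τ.take l) (s.take l) := by
      refine PrimrecPred.and ?_ (PrimrecPred.and hQ ?_)
      · exact PrimrecRel.comp Primrec.eq (Primrec.list_length.comp Primrec.snd)
          (Primrec.list_length.comp Primrec.fst)
      · have h2 : PrimrecRel fun (l : ℕ) (p : List Bool × List Bool) =>
            ¬ Q (p.1.take l) (p.2.take l) :=
          (PrimrecRel.comp hQ (Primrec.list_take.comp Primrec.fst (Primrec.fst.comp Primrec.snd))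
            (Primrec.list_take.comp Primrec.fst (Primrec.snd.comp Primrec.snd))).not
        exact PrimrecRel.comp h2.forall_mem_list (Primrec.list_range.comp
          (Primrec.list_length.comp Primrec.fst)) Primrec.id
    refine CE.of_exists_prefix h1 fun τ => ?_
    simp only [length_initSeg, exists_eq_left, List.mem_range]
    refine and_congr Iff.rfl (forall₂_congr fun l hl => not_congr ?_)
    rw [take_initSeg A hl.le]
    simp only [P, List.length_take, min_eq_left hl.le]
  · ext X
    rw [mem_openSet, mem_openSet]
    constructor
    · rintro ⟨n, ⟨i, hi, h⟩, -⟩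
      rw [take_initSeg X (by simpa [Nat.lt_succ_iff] using hi)] at h
      exact ⟨i, (hS _).2 ⟨_, h⟩⟩
    · rintro ⟨n, h⟩
      obtain ⟨m, hm⟩ := (hS _).1 h
      have hex : ∃ k, P (initSeg X k) := by
        refine ⟨max n m, n, by simp, ?_⟩
        rw [take_initSeg X (le_max_left _ _), length_initSeg]
        exact mR _ _ _ (initSeg_prefix A (le_max_right _ _)) hm
      classical
      refine ⟨Nat.find hex, Nat.find_spec hex, fun l hl => ?_⟩
      rw [length_initSeg] at hl
      rw [take_initSeg X hl.le]
      exact Nat.find_min hex hl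

end PrefixFree
-- The measure of cylinders and open sets
section Measure
open scoped ENNReal

instance : IsProbabilityMeasure lebesgue := by
  unfold lebesgue; infer_instance

theorem mem_cyl {σ : List Bool} {X : Cantor} : X ∈ cyl σ ↔ initSeg X σ.length = σ := Iff.rfl

theorem mem_cyl_iff_getElem {σ : List Bool} {X : Cantor} :
    X ∈ cyl σ ↔ ∀ i (h : i < σ.length), X i = σ[i] := by
  rw [mem_cyl]
  constructor
  · intro h i hi
    have h1 := getElem?_initSeg X σ.length i
    rw [h, if_pos hi, List.getElem?_eq_getElem hi] at h1
    exact (Option.some.inj h1).symm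
  · intro h
    refine List.ext_getElem? fun i => ?_
    rw [getElem?_initSeg]
    split_ifs with hi
    · rw [List.getElem?_eq_getElem hi, h i hi]
    · rw [List.getElem?_eq_none (not_lt.1 hi)]

theorem cyl_eq_pi (σ : List Bool) :
    cyl σ = Set.pi (Finset.range σ.length : Set ℕ) fun i => {σ.getD i false} := by
  ext X
  rw [mem_cyl_iff_getElem]
  simp only [Set.mem_pi, Finset.coe_range, Set.mem_Iio, Set.mem_singleton_iff]
  exact forall₂_congr fun i hi => by simp [List.getD, List.getElem?_eq_getElem hi]

theorem measurableSet_cyl (σ : List Bool) : MeasurableSet (cyl σ) := by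
  rw [cyl_eq_pi]
  exact MeasurableSet.pi (Finset.countable_toSet _) fun i _ => measurableSet_singleton _

theorem measurableSet_openSet (U : Set (List Bool)) : MeasurableSet (openSet U) :=
  MeasurableSet.biUnion (Set.to_countable _) fun σ _ => measurableSet_cyl σ

theorem lebesgue_cyl (σ : List Bool) : lebesgue (cyl σ) = 2⁻¹ ^ σ.length := by
  rw [cyl_eq_pi, lebesgue, Measure.infinitePi_pi _ fun i _ => measurableSet_singleton _]
  rw [Finset.prod_congr rfl (g := fun _ => (2⁻¹ : ℝ≥0∞))]
  · simp
  · intro i _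
    rw [PMF.toMeasure_apply_singleton _ _ (measurableSet_singleton _)]
    simp

theorem prefix_or_prefix_of_mem_cyl {σ τ : List Bool} {X : Cantor} (h : X ∈ cyl σ)
    (h' : X ∈ cyl τ) : σ <+: τ ∨ τ <+: σ := by
  rw [mem_cyl] at h h'
  rw [← h, ← h']
  rcases le_total σ.length τ.length with h1 | h1
  · exact Or.inl (initSeg_prefix X h1)
  · exact Or.inr (initSeg_prefix X h1)

theorem PrefixFree.pairwiseDisjoint {U : Set (List Bool)} (hU : PrefixFree U) :
    U.PairwiseDisjoint cyl := by
  intro σ hσ τ hτ hne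
  refine Set.disjoint_left.2 fun X h h' => hne ?_
  rcases prefix_or_prefix_of_mem_cyl h h' with h1 | h1
  · exact hU σ hσ τ hτ h1
  · exact (hU τ hτ σ hσ h1).symm

theorem PrefixFree.lebesgue_openSet {U : Set (List Bool)} (hU : PrefixFree U) :
    lebesgue (openSet U) = ∑' σ : U, 2⁻¹ ^ σ.1.length := by
  rw [openSet, measure_biUnion (Set.to_countable _) hU.pairwiseDisjoint
    fun σ _ => measurableSet_cyl σ]
  simp_rw [lebesgue_cyl]

theorem lebesgue_openSet_finset {G : Finset (List Bool)} {M : ℕ} (hG : ∀ τ ∈ G, τ.length = M) :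
    lebesgue (openSet (G : Set (List Bool))) = G.card * 2⁻¹ ^ M := by
  have h1 : PrefixFree (G : Set (List Bool)) := fun σ hσ τ hτ h =>
    h.eq_of_length (by rw [hG σ hσ, hG τ hτ])
  rw [openSet, measure_biUnion (Set.to_countable _) h1.pairwiseDisjoint
    fun σ _ => measurableSet_cyl σ]
  rw [tsum_congr (g := fun _ => (2⁻¹ : ℝ≥0∞) ^ M)
    fun σ => by rw [lebesgue_cyl, hG _ σ.2]]
  simp

/-- The cylinders outside `E` add at most the tail of the weight. The bound is arranged additively
to avoid truncated subtraction. -/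
theorem lebesgue_iUnion_cyl_union_le {ι : Type} [Countable ι] (f : ι → List Bool) (E : Finset ι)
    (L : Set Cantor) :
    lebesgue ((⋃ i, cyl (f i)) ∪ L) + ∑ i ∈ E, 2⁻¹ ^ (f i).length ≤
      lebesgue ((⋃ i ∈ E, cyl (f i)) ∪ L) + ∑' i, 2⁻¹ ^ (f i).length := by
  have h1 : (⋃ i, cyl (f i)) ∪ L ⊆
      ((⋃ i ∈ E, cyl (f i)) ∪ L) ∪ ⋃ i : ↥((E : Set ι)ᶜ), cyl (f i) := by
    rintro X (h | h)
    · obtain ⟨i, hi⟩ := Set.mem_iUnion.1 h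
      by_cases hE : i ∈ E
      · exact Or.inl (Or.inl (Set.mem_biUnion hE hi))
      · exact Or.inr (Set.mem_iUnion.2 ⟨⟨i, hE⟩, hi⟩)
    · exact Or.inl (Or.inr h)
  rw [← ENNReal.sum_add_tsum_compl E]
  calc _ ≤ (lebesgue ((⋃ i ∈ E, cyl (f i)) ∪ L) +
        ∑' i : ↥((E : Set ι)ᶜ), 2⁻¹ ^ (f i).length) + ∑ i ∈ E, 2⁻¹ ^ (f i).length := by
        gcongr
        refine (measure_mono h1).trans ((measure_union_le _ _).trans ?_)
        gcongr
        refine (measure_iUnion_le _).trans (le_of_eq (tsum_congr fun i => lebesgue_cyl _))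
    _ = _ := by ring

end Measure

/-! ### Powers of a set of strings -/

section Powers

/-- The strings that are concatenations of `n` elements of `U`. -/
def concatPow (U : Set (List Bool)) : ℕ → Set (List Bool)
  | 0 => {[]}
  | n + 1 => (fun p : List Bool × List Bool => p.1 ++ p.2) '' (concatPow U n ×ˢ U)

theorem mem_concatPow_succ {U : Set (List Bool)} {n : ℕ} {σ : List Bool} :
    σ ∈ concatPow U (n + 1) ↔ ∃ ρ ∈ concatPow U n, ∃ τ ∈ U, ρ ++ τ = σ := by
  simp [concatPow]

theorem mem_concatPow {U : Set (List Bool)} {n : ℕ} {σ : List Bool} :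
    σ ∈ concatPow U n ↔ ∃ l : List (List Bool), (l.length = n ∧ l.flatten = σ) ∧ ∀ τ ∈ l, τ ∈ U := by
  induction n generalizing σ with
  | zero => simp [concatPow, eq_comm]
  | succ n ih =>
    rw [mem_concatPow_succ]
    constructor
    · rintro ⟨ρ, hρ, τ, hτ, rfl⟩
      obtain ⟨l, ⟨h1, h2⟩, h3⟩ := ih.1 hρ
      refine ⟨l ++ [τ], ⟨by simp [h1], by simp [h2]⟩, fun x hx => ?_⟩
      rcases List.mem_append.1 hx with hx | hx
      · exact h3 x hx
      · rwa [List.mem_singleton.1 hx]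
    · rintro ⟨l, ⟨h1, rfl⟩, h3⟩
      obtain ⟨l, τ, rfl⟩ : ∃ l' τ, l = l' ++ [τ] :=
        ⟨l.dropLast, l.getLast (by rintro rfl; simp at h1), (List.dropLast_append_getLast _).symm⟩
      refine ⟨l.flatten, ih.2 ⟨l, ⟨by simpa using h1, rfl⟩, fun x hx => h3 x (by simp [hx])⟩, τ,
        h3 τ (by simp), by simp⟩

theorem PrefixFree.eq_of_append_prefix {U : Set (List Bool)} (hU : PrefixFree U)
    {σ σ' τ τ' : List Bool} (hσ : σ ∈ U) (hσ' : σ' ∈ U) (h : σ ++ τ <+: σ' ++ τ') :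
    σ = σ' ∧ τ <+: τ' := by
  have h1 : σ <+: σ' ++ τ' := (List.prefix_append _ _).trans h
  have h2 : σ = σ' := by
    rcases List.prefix_or_prefix_of_prefix h1 (List.prefix_append σ' τ') with h3 | h3
    · exact hU _ hσ _ hσ' h3
    · exact (hU _ hσ' _ hσ h3).symm
  subst h2
  exact ⟨rfl, (List.prefix_append_right_inj _).1 h⟩

theorem PrefixFree.concatPow {U : Set (List Bool)} (hU : PrefixFree U) (n : ℕ) :
    PrefixFree (concatPow U n) := by
  induction n with
  | zero =>
    rintro σ rfl τ rfl -
    rfl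
  | succ n ih =>
    intro σ hσ τ hτ h
    obtain ⟨ρ, hρ, κ, hκ, rfl⟩ := mem_concatPow_succ.1 hσ
    obtain ⟨ρ', hρ', κ', hκ', rfl⟩ := mem_concatPow_succ.1 hτ
    obtain ⟨rfl, h2⟩ := ih.eq_of_append_prefix hρ hρ' h
    rw [hU _ hκ _ hκ' h2]

/-- Strings over a prefix-free set decode uniquely, so concatenation is injective on pairs, and the
weight of a concatenation is the product of the weights. -/
theorem PrefixFree.lebesgue_concatPow {U : Set (List Bool)} (hU : PrefixFree U) (n : ℕ) :
    lebesgue (openSet (OpenCovers.concatPow U n)) = lebesgue (openSet U) ^ n := by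
  induction n with
  | zero =>
    have h1 : openSet (OpenCovers.concatPow U 0) = Set.univ :=
      Set.eq_univ_of_forall fun X => mem_openSet.2 ⟨0, rfl⟩
    rw [h1, measure_univ, pow_zero]
  | succ n ih =>
    rw [pow_succ, ← ih, (hU.concatPow _).lebesgue_openSet, hU.lebesgue_openSet,
      (hU.concatPow _).lebesgue_openSet, ← ENNReal.tsum_mul_right]
    simp_rw [← ENNReal.tsum_mul_left]
    have hinj : Set.InjOn (fun p : List Bool × List Bool => p.1 ++ p.2)
        (OpenCovers.concatPow U n ×ˢ U) := by
      rintro ⟨σ, τ⟩ ⟨hσ, hτ⟩ ⟨σ', τ'⟩ ⟨hσ', hτ'⟩ h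
      obtain ⟨h1, h2⟩ := (hU.concatPow n).eq_of_append_prefix hσ hσ'
        ⟨[], (List.append_nil _).trans h⟩
      exact Prod.ext h1 (hU _ hτ _ hτ' h2)
    rw [OpenCovers.concatPow, tsum_image (fun σ : List Bool => (2⁻¹ : ENNReal) ^ σ.length) hinj,
      ← ENNReal.tsum_prod, ← (Equiv.Set.prod (OpenCovers.concatPow U n) U).symm.tsum_eq]
    refine tsum_congr fun p => ?_
    simp only [List.length_append, pow_add]
    rfl

theorem CE.concatPow {A : Cantor} {U : Set (List Bool)} (hU : CE A fun σ => σ ∈ U) :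
    CE A fun p : ℕ × List Bool => p.2 ∈ concatPow U p.1 := by
  refine CE.of_eq ?_ fun p => mem_concatPow.symm
  refine CE.exists (S := fun (p : ℕ × List Bool) (l : List (List Bool)) =>
    (l.length = p.1 ∧ l.flatten = p.2) ∧ ∀ τ ∈ l, τ ∈ U) ?_
  refine (CE.of_primrec ((PrimrecRel.comp Primrec.eq (Primrec.list_length.comp Primrec.snd)
    (Primrec.fst.comp Primrec.fst)).and (PrimrecRel.comp Primrec.eq
      (Primrec.list_flatten.comp Primrec.snd) (Primrec.snd.comp Primrec.fst)))).and ?_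
  exact (CE.forall_mem (S := fun (_ : Unit) τ => τ ∈ U) (hU.comp Primrec.snd)).comp
    (Primrec.pair (Primrec.const ()) Primrec.snd)

theorem openSet_concatPow_antitone (U : Set (List Bool)) :
    Antitone fun n => openSet (concatPow U n) := by
  refine antitone_nat_of_succ_le fun n X hX => ?_
  obtain ⟨k, hk⟩ := mem_openSet.1 hX
  obtain ⟨ρ, hρ, τ, -, h⟩ := mem_concatPow_succ.1 hk
  have h1 := (prefix_initSeg_iff.1 (h ▸ List.prefix_append ρ τ : ρ <+: initSeg X k)).2
  exact mem_openSet.2 ⟨ρ.length, by rwa [h1]⟩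

end Powers
-- Filling from the left in lexicographic order
section Lex
open scoped ENNReal

/-- The number with binary representation `σ`. -/
def binVal (σ : List Bool) : ℕ := σ.foldl (fun n b => 2 * n + b.toNat) 0

theorem binVal_concat (σ : List Bool) (b : Bool) : binVal (σ ++ [b]) = 2 * binVal σ + b.toNat := by
  simp [binVal]

theorem primrec_binVal : Primrec binVal :=
  Primrec.list_foldl Primrec.id (Primrec.const 0)
    (Primrec.nat_add.comp (Primrec.nat_mul.comp (Primrec.const 2) (Primrec.fst.comp Primrec.snd))
      ((Primrec.dom_bool Bool.toNat).comp (Primrec.snd.comp Primrec.snd))).to₂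

theorem binVal_initSeg_succ (X : Cantor) (n : ℕ) :
    binVal (initSeg X (n + 1)) = 2 * binVal (initSeg X n) + (X n).toNat := by
  rw [initSeg_succ, binVal_concat]

theorem binVal_initSeg_lt (X : Cantor) (n : ℕ) : binVal (initSeg X n) < 2 ^ n := by
  induction n with
  | zero => simp [binVal]
  | succ n ih =>
    rw [binVal_initSeg_succ, pow_succ]
    have := Bool.toNat_le (X n)
    omega

theorem initSeg_eq_of_binVal_eq {X Y : Cantor} {n : ℕ}
    (h : binVal (initSeg X n) = binVal (initSeg Y n)) : initSeg X n = initSeg Y n := by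
  induction n with
  | zero => rfl
  | succ n ih =>
    rw [binVal_initSeg_succ, binVal_initSeg_succ] at h
    have h1 := Bool.toNat_le (X n)
    have h2 := Bool.toNat_le (Y n)
    have h3 : X n = Y n := by
      have : (X n).toNat = (Y n).toNat := by omega
      revert this
      cases X n <;> cases Y n <;> simp
    rw [initSeg_succ, initSeg_succ, ih (by omega), h3]

/-- The sequences lexicographically below the dyadic rational `k / 2 ^ m`. -/
def lexBelow (m k : ℕ) : Set Cantor := {X | binVal (initSeg X m) < k}

theorem mem_lexBelow {m k : ℕ} {X : Cantor} : X ∈ lexBelow m k ↔ binVal (initSeg X m) < k := Iff.rfl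

theorem lexBelow_add (m k j : ℕ) : lexBelow (m + j) (k * 2 ^ j) = lexBelow m k := by
  induction j with
  | zero => simp
  | succ j ih =>
    rw [← ih]
    ext X
    rw [mem_lexBelow, mem_lexBelow, ← add_assoc, binVal_initSeg_succ, pow_succ, ← mul_assoc]
    have := Bool.toNat_le (X (m + j))
    omega

theorem lexBelow_mono (m : ℕ) : Monotone (lexBelow m) := fun _ _ h _ hX => lt_of_lt_of_le hX h

/-- Brought to the common level `m + m'`, the two sets differ only in their right endpoints. Hence
the sets form a chain, and the measure of a union of them is a supremum. -/
theorem lexBelow_total (m k m' k' : ℕ) :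
    lexBelow m k ⊆ lexBelow m' k' ∨ lexBelow m' k' ⊆ lexBelow m k := by
  rw [← lexBelow_add m k m', ← lexBelow_add m' k' m, add_comm m' m]
  exact (le_total _ _).imp (fun h => lexBelow_mono _ h) (fun h => lexBelow_mono _ h)

theorem lebesgue_binVal_eq_le (m k : ℕ) :
    lebesgue {X | binVal (initSeg X m) = k} ≤ 2⁻¹ ^ m := by
  by_cases h : ∃ X : Cantor, binVal (initSeg X m) = k
  · obtain ⟨X, hX⟩ := h
    calc _ ≤ lebesgue (cyl (initSeg X m)) := measure_mono fun Y hY => by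
            rw [mem_cyl, length_initSeg]
            exact initSeg_eq_of_binVal_eq (hY.trans hX.symm)
      _ = _ := by rw [lebesgue_cyl, length_initSeg]
  · rw [show {X : Cantor | binVal (initSeg X m) = k} = ∅ from
      Set.eq_empty_of_forall_notMem fun X hX => h ⟨X, hX⟩]
    simp

/-- Filling up `V` from the left, in lexicographic order, up to any measure `θ < 1` yields a set of
measure exactly `θ`. -/
theorem lebesgue_fill {V : Set Cantor} {θ : ℝ≥0∞} (hV : lebesgue V ≤ θ) (hθ : θ < 1) :
    lebesgue (V ∪ ⋃ p : {p : ℕ × ℕ // lebesgue (V ∪ lexBelow p.1 p.2) < θ},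
      lexBelow p.1.1 p.1.2) = θ := by
  rcases eq_or_lt_of_le hV with h | hlt
  · have : IsEmpty {p : ℕ × ℕ // lebesgue (V ∪ lexBelow p.1 p.2) < θ} :=
      ⟨fun p => absurd p.2 (not_lt.2 (h.ge.trans (measure_mono Set.subset_union_left)))⟩
    rw [Set.iUnion_of_empty, Set.union_empty]
    exact h
  have hzero : ∀ m, lebesgue (V ∪ lexBelow m 0) < θ := fun m => by
    rw [show lexBelow m 0 = ∅ from Set.eq_empty_of_forall_notMem fun X hX => Nat.not_lt_zero _ hX,
      Set.union_empty]
    exact hlt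
  have : Nonempty {p : ℕ × ℕ // lebesgue (V ∪ lexBelow p.1 p.2) < θ} := ⟨⟨(0, 0), hzero 0⟩⟩
  apply le_antisymm
  · rw [Set.union_iUnion, Directed.measure_iUnion]
    · exact iSup_le fun p => p.2.le
    · rintro ⟨p, hp⟩ ⟨q, hq⟩
      rcases lexBelow_total p.1 p.2 q.1 q.2 with h | h
      · exact ⟨⟨q, hq⟩, Set.union_subset_union_right _ h, le_rfl⟩
      · exact ⟨⟨p, hp⟩, le_rfl, Set.union_subset_union_right _ h⟩
  · refine ENNReal.le_of_forall_pos_le_add fun ε hε _ => ?_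
    obtain ⟨m, hm⟩ : ∃ m : ℕ, (2⁻¹ : ℝ≥0∞) ^ m < ε :=
      ENNReal.exists_inv_two_pow_lt (by simpa using hε.ne')
    classical
    -- At level `m`, take the last `k` that keeps the measure below `θ`; one more interval, of
    -- measure at most `2⁻ᵐ < ε`, reaches `θ`.
    have hex : ∃ k, ¬ lebesgue (V ∪ lexBelow m k) < θ := by
      refine ⟨2 ^ m, not_lt.2 ?_⟩
      rw [show lexBelow m (2 ^ m) = Set.univ from
        Set.eq_univ_of_forall fun X => binVal_initSeg_lt X m]
      simpa using hθ.le
    have hk := Nat.find_spec hex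
    have hmin := fun {k} => Nat.find_min hex (m := k)
    rcases Nat.eq_zero_or_eq_succ_pred (Nat.find hex) with h0 | h0
    · exact absurd (hzero m) (h0 ▸ hk)
    · set k := (Nat.find hex).pred
      have hgood : lebesgue (V ∪ lexBelow m k) < θ := by
        by_contra hcon
        exact hmin (by omega) hcon
      rw [h0] at hk
      calc θ ≤ lebesgue (V ∪ lexBelow m k.succ) := not_lt.1 hk
        _ ≤ lebesgue ((V ∪ lexBelow m k) ∪ {X | binVal (initSeg X m) = k}) := by
            refine measure_mono ?_
            rintro X (hX | hX)
            · exact Or.inl (Or.inl hX)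
            · rcases Nat.lt_succ_iff_lt_or_eq.1 hX with h | h
              · exact Or.inl (Or.inr h)
              · exact Or.inr h
        _ ≤ lebesgue (V ∪ lexBelow m k) + 2⁻¹ ^ m :=
            (measure_union_le _ _).trans (by gcongr; exact lebesgue_binVal_eq_le m k)
        _ ≤ _ := by
            refine add_le_add (measure_mono (Set.union_subset_union_right _ ?_)) hm.le
            exact Set.subset_iUnion (fun p : {p : ℕ × ℕ // lebesgue (V ∪ lexBelow p.1 p.2) < θ} =>
              lexBelow p.1.1 p.1.2) ⟨(m, k), hgood⟩

end Lex

/-! ### Finite certificates for an upper bound on the measure -/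

section Certificate
open scoped ENNReal
variable {β : Type}

/-- The decidable part of a certificate that `lexBelow p.1 p.2` together with the cylinders of the
strings `f x` has measure less than one half: finitely many indices `x` (the list `E`), finitely many
strings of length `M` avoiding the set (the list `G`), and a bound `a / b` for the total weight. -/
def IsCertificate (f : β → List Bool) (p : ℕ × ℕ)
    (c : (List β × List (List Bool)) × (ℕ × ℕ × ℕ)) : Prop :=
  (c.1.1.Nodup ∧ c.1.2.Nodup ∧ p.1 ≤ c.2.1) ∧
  (∀ x ∈ c.1.1, (f x).length ≤ c.2.1) ∧
  (∀ τ ∈ c.1.2, (τ.length = c.2.1 ∧ ¬ binVal (τ.take p.1) < p.2) ∧ ∀ x ∈ c.1.1, ¬ f x <+: τ) ∧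
  2 * c.2.2.2 * 2 ^ c.2.1 + 2 * c.2.2.1 * 2 ^ c.2.1 <
    c.2.2.2 * 2 ^ c.2.1 + 2 * c.2.2.2 * c.1.2.length +
      2 * c.2.2.2 * (c.1.1.map fun x => 2 ^ (c.2.1 - (f x).length)).sum

theorem primrec_pow : Primrec₂ ((· ^ ·) : ℕ → ℕ → ℕ) := Primrec₂.unpaired'.1 Nat.Primrec.pow

theorem primrecPred_nodup {α : Type} [Primcodable α] : PrimrecPred fun l : List α => l.Nodup := by
  classical
  have h1 : Primrec fun l : List α => (List.rec true
      (fun b t IH => decide (¬ ∃ c ∈ t, c = b) && IH) l : Bool) := by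
    have h3 : PrimrecRel fun (t : List α) (b : α) => ¬ ∃ c ∈ t, c = b :=
      (PrimrecRel.exists_mem_list Primrec.eq).not
    have h2 : Primrec₂ fun (_ : List α) (x : α × List α × Bool) =>
        decide (¬ ∃ c ∈ x.2.1, c = x.1) && x.2.2 :=
      Primrec.and.comp
        (PrimrecPred.decide (PrimrecRel.comp (f := fun y : List α × α × List α × Bool => y.2.2.1)
          (g := fun y => y.2.1) h3 (Primrec.fst.comp (Primrec.snd.comp Primrec.snd))
          (Primrec.fst.comp Primrec.snd)))
        (Primrec.snd.comp (Primrec.snd.comp Primrec.snd))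
    exact Primrec.list_rec Primrec.id (Primrec.const true) h2
  refine Primrec.primrecPred (h1.of_eq fun l => ?_)
  induction l with
  | nil => simp
  | cons b t ih =>
    refine (congrArg (decide (¬ ∃ c ∈ t, c = b) && ·) ih).trans ?_
    simp

theorem primrecRel_prefix : PrimrecRel fun σ τ : List Bool => σ <+: τ :=
  (PrimrecRel.comp Primrec.eq Primrec.fst (Primrec.list_take.comp
    (Primrec.list_length.comp Primrec.fst) Primrec.snd)).of_eq fun _ => List.prefix_iff_eq_take.symm

theorem primrec_list_sum : Primrec fun l : List ℕ => l.sum :=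
  (Primrec.list_foldr Primrec.id (Primrec.const 0)
    (Primrec.nat_add.comp (Primrec.fst.comp Primrec.snd) (Primrec.snd.comp Primrec.snd)).to₂).of_eq
    fun l => by rw [List.sum_eq_foldr]; rfl

theorem primrecRel_isCertificate [Primcodable β] {f : β → List Bool} (hf : Primrec f) :
    PrimrecRel (IsCertificate f) := by
  have hE : Primrec fun q : (ℕ × ℕ) × (List β × List (List Bool)) × (ℕ × ℕ × ℕ) => q.2.1.1 :=
    Primrec.fst.comp (Primrec.fst.comp Primrec.snd)
  have hG : Primrec fun q : (ℕ × ℕ) × (List β × List (List Bool)) × (ℕ × ℕ × ℕ) => q.2.1.2 :=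
    Primrec.snd.comp (Primrec.fst.comp Primrec.snd)
  have hM : Primrec fun q : (ℕ × ℕ) × (List β × List (List Bool)) × (ℕ × ℕ × ℕ) => q.2.2.1 :=
    Primrec.fst.comp (Primrec.snd.comp Primrec.snd)
  have ha : Primrec fun q : (ℕ × ℕ) × (List β × List (List Bool)) × (ℕ × ℕ × ℕ) => q.2.2.2.1 :=
    Primrec.fst.comp (Primrec.snd.comp (Primrec.snd.comp Primrec.snd))
  have hb : Primrec fun q : (ℕ × ℕ) × (List β × List (List Bool)) × (ℕ × ℕ × ℕ) => q.2.2.2.2 :=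
    Primrec.snd.comp (Primrec.snd.comp (Primrec.snd.comp Primrec.snd))
  have hpow := primrec_pow.comp (Primrec.const 2) hM
  have h2b := Primrec.nat_mul.comp (Primrec.const 2) hb
  refine PrimrecPred.and ?_ (PrimrecPred.and ?_ (PrimrecPred.and ?_ ?_))
  · exact (primrecPred_nodup.comp hE).and ((primrecPred_nodup.comp hG).and
      (Primrec.nat_le.comp (Primrec.fst.comp Primrec.fst) hM))
  · have h1 : PrimrecRel fun (x : β) (M : ℕ) => (f x).length ≤ M :=
      PrimrecRel.comp Primrec.nat_le (Primrec.list_length.comp (hf.comp Primrec.fst)) Primrec.snd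
    exact h1.forall_mem_list.comp hE hM
  · have h1 : PrimrecRel fun (x : β) (τ : List Bool) => ¬ f x <+: τ :=
      (primrecRel_prefix.comp (hf.comp Primrec.fst) Primrec.snd).not
    have h2 : PrimrecRel fun (τ : List Bool) (q : (ℕ × ℕ) × (List β × List (List Bool)) ×
        (ℕ × ℕ × ℕ)) => (τ.length = q.2.2.1 ∧ ¬ binVal (τ.take q.1.1) < q.1.2) ∧
          ∀ x ∈ q.2.1.1, ¬ f x <+: τ := by
      refine ((PrimrecRel.comp Primrec.eq (Primrec.list_length.comp Primrec.fst)
        (hM.comp Primrec.snd)).and ?_).and ?_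
      · exact (Primrec.nat_lt.comp (primrec_binVal.comp (Primrec.list_take.comp
          (Primrec.fst.comp (Primrec.fst.comp Primrec.snd)) Primrec.fst))
          (Primrec.snd.comp (Primrec.fst.comp Primrec.snd))).not
      · exact h1.forall_mem_list.comp (hE.comp Primrec.snd) Primrec.fst
    exact h2.forall_mem_list.comp hG Primrec.id
  · refine Primrec.nat_lt.comp ?_ ?_
    · exact Primrec.nat_add.comp (Primrec.nat_mul.comp h2b hpow) (Primrec.nat_mul.comp
        (Primrec.nat_mul.comp (Primrec.const 2) ha) hpow)
    · refine Primrec.nat_add.comp (Primrec.nat_add.comp (Primrec.nat_mul.comp hb hpow)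
        (Primrec.nat_mul.comp h2b (Primrec.list_length.comp hG))) (Primrec.nat_mul.comp h2b
        (primrec_list_sum.comp (Primrec.list_map hE ?_)))
      exact primrec_pow.comp (Primrec.const 2) (Primrec.nat_sub.comp (hM.comp Primrec.fst)
        (Primrec.list_length.comp (hf.comp Primrec.snd)))

end Certificate
-- Soundness and completeness of certificates; padding to measure one half
section Padding
open scoped ENNReal
variable {β : Type}

/-- Both sides are multiplied by `2 * b * 2 ^ M`, which turns the real estimate into a decidable one
between natural numbers. -/
theorem certificate_inequality_iff {f : β → List Bool} {E : List β} {M a b : ℕ} (g : ℕ)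
    (hb : 0 < b) (hE : ∀ x ∈ E, (f x).length ≤ M) :
    2 * b * 2 ^ M + 2 * a * 2 ^ M < b * 2 ^ M + 2 * b * g +
        2 * b * (E.map fun x => 2 ^ (M - (f x).length)).sum ↔
      (1 : ℝ) + a / b < 1 / 2 + g * 2⁻¹ ^ M + (E.map fun x => (2⁻¹ : ℝ) ^ (f x).length).sum := by
  have h1 : (((E.map fun x => 2 ^ (M - (f x).length)).sum : ℕ) : ℝ) =
      2 ^ M * (E.map fun x => (2⁻¹ : ℝ) ^ (f x).length).sum := by
    induction E with
    | nil => simp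
    | cons x E ih =>
      simp only [List.map_cons, List.sum_cons, Nat.cast_add, mul_add]
      rw [ih fun y hy => hE y (by simp [hy])]
      congr 1
      push_cast
      rw [pow_sub₀ _ two_ne_zero (hE x (by simp)), inv_pow]
  have hb' : (0 : ℝ) < b := by exact_mod_cast hb
  have hM : (0 : ℝ) < 2 ^ M := by positivity
  rw [← Nat.cast_lt (α := ℝ)]
  push_cast [h1]
  set s := (E.map fun x => (2⁻¹ : ℝ) ^ (f x).length).sum
  have key : ∀ u : ℝ, 0 < u ↔ 0 < u * (2 * b * 2 ^ M) := fun u =>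
    ⟨fun h => by positivity, fun h => pos_of_mul_pos_left h (by positivity)⟩
  rw [← sub_pos, ← sub_pos (a := 1 / 2 + _ + _), key (1 / 2 + _ + _ - _)]
  refine iff_of_eq (congrArg _ ?_)
  rw [inv_pow]
  field_simp

theorem toReal_two_inv_pow (n : ℕ) : ((2⁻¹ : ℝ≥0∞) ^ n).toReal = 2⁻¹ ^ n := by
  simp [ENNReal.toReal_pow, ENNReal.toReal_inv]

theorem ratCast_eq_toNat_div {r : ℚ} (hr : 0 < r) : (r : ℝ) = (r.num.toNat : ℝ) / r.den := by
  have h : ((r.num.toNat : ℤ) : ℝ) = r.num := by rw [Int.toNat_of_nonneg (Rat.num_pos.2 hr).le]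
  conv_lhs => rw [← Rat.num_div_den r]
  push_cast
  rw [← h]
  push_cast
  rfl

variable {W : β → Prop}

theorem exists_finset_of_list {E : List β} (hE : E.Nodup) (hW : ∀ x ∈ E, W x) :
    ∃ F : Finset {x // W x}, (∀ i : {x // W x}, i ∈ F ↔ i.1 ∈ E) ∧
      ∀ g : β → ℝ, ∑ i ∈ F, g i.1 = (E.map g).sum := by
  classical
  refine ⟨(E.attach.map fun x => (⟨x.1, hW x.1 x.2⟩ : {x // W x})).toFinset, fun i => ?_,
    fun g => ?_⟩
  · simp only [List.mem_toFinset, List.mem_map, List.mem_attach, true_and, Subtype.exists]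
    constructor
    · rintro ⟨x, hx, rfl⟩
      exact hx
    · intro h
      exact ⟨i.1, h, rfl⟩
  · rw [List.sum_toFinset, List.map_map]
    · conv_rhs => rw [← List.attach_map_subtype_val E, List.map_map]
      rfl
    · refine List.Nodup.map (fun x y h => ?_) (List.nodup_attach.2 hE)
      exact Subtype.ext (congrArg Subtype.val h :)

theorem toReal_sum_inv_pow {ι : Type} (F : Finset ι) (f : ι → List Bool) :
    (∑ i ∈ F, (2⁻¹ : ℝ≥0∞) ^ (f i).length).toReal = ∑ i ∈ F, 2⁻¹ ^ (f i).length := by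
  rw [ENNReal.toReal_sum fun i _ => by simp]
  simp_rw [toReal_two_inv_pow]

/-- The finite part avoids the cylinders of `G`, so its measure is at most `1 - G.length * 2⁻¹ ^ M`.
The remaining cylinders add at most `S` minus the weight of `E`, and `S < a / b`. The certificate
inequality says that these bounds total less than `1 / 2`. -/
theorem IsCertificate.lebesgue_lt [Countable β] {f : β → List Bool} {p : ℕ × ℕ}
    {c : (List β × List (List Bool)) × (ℕ × ℕ × ℕ)} (h : IsCertificate f p c)
    (hW : ∀ x ∈ c.1.1, W x) (hb : 0 < c.2.2.2) {S : ℝ≥0∞}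
    (hS : ∑' x : {x // W x}, 2⁻¹ ^ (f x.1).length = S) (hab : S * c.2.2.2 < c.2.2.1) :
    lebesgue ((⋃ x : {x // W x}, cyl (f x.1)) ∪ lexBelow p.1 p.2) < 1 / 2 := by
  obtain ⟨⟨E, G⟩, M, a, b⟩ := c
  obtain ⟨m, k⟩ := p
  obtain ⟨⟨hE, hG, hm⟩, hEM, hGM, hlt⟩ := h
  dsimp only at *
  classical
  obtain ⟨F, hF, hFsum⟩ := exists_finset_of_list hE hW
  rw [certificate_inequality_iff _ hb hEM, ← hFsum] at hlt
  have hSfin : S ≠ ∞ := by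
    rintro rfl
    rw [ENNReal.top_mul (by exact_mod_cast hb.ne')] at hab
    exact not_top_lt hab
  have hab' : S.toReal < a / b := by
    rw [lt_div_iff₀ (by exact_mod_cast hb)]
    have := (ENNReal.toReal_lt_toReal (ENNReal.mul_ne_top hSfin (by simp)) (by simp)).2 hab
    simpa using this
  have h1 := lebesgue_iUnion_cyl_union_le (fun i : {x // W x} => f i.1) F (lexBelow m k)
  rw [hS] at h1
  have hGcard := lebesgue_openSet_finset (G := G.toFinset) (M := M)
    fun τ hτ => (hGM τ (by simpa using hτ)).1.1
  rw [List.toFinset_card_of_nodup hG] at hGcard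
  have h2 : lebesgue ((⋃ i ∈ F, cyl (f i.1)) ∪ lexBelow m k) + G.length * 2⁻¹ ^ M ≤ 1 := by
    rw [← hGcard, ← measure_union _ (measurableSet_openSet _)]
    · exact prob_le_one
    · refine Set.disjoint_right.2 fun X hX => ?_
      simp only [openSet, Set.mem_iUnion, exists_prop, List.coe_toFinset, Set.mem_ofPred_eq] at hX
      obtain ⟨τ, hτ, hX⟩ := hX
      obtain ⟨⟨h3, h4⟩, h5⟩ := hGM τ hτ
      rw [mem_cyl, h3] at hX
      rintro (h | h)
      · simp only [Set.mem_iUnion] at h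
        obtain ⟨i, hi, h⟩ := h
        refine h5 i.1 ((hF i).1 hi) ?_
        rw [← hX]
        exact prefix_initSeg_iff.2 ⟨hEM _ ((hF i).1 hi), h⟩
      · refine h4 ?_
        rw [← hX, take_initSeg X hm]
        exact h
  have h1' := ENNReal.toReal_mono (by simp [hSfin]) h1
  have h2' := ENNReal.toReal_mono (by simp) h2
  rw [ENNReal.toReal_add (by simp) (by simp), ENNReal.toReal_add (by simp) hSfin,
    toReal_sum_inv_pow] at h1'
  rw [ENNReal.toReal_add (by simp) (ENNReal.mul_ne_top (by simp) (by simp)), ENNReal.toReal_mul,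
    toReal_two_inv_pow] at h2'
  rw [← ENNReal.toReal_lt_toReal (by simp) (by simp)]
  simp only [ENNReal.toReal_natCast, ENNReal.toReal_one] at h2'
  rw [ENNReal.toReal_div]
  simp only [ENNReal.toReal_one, ENNReal.toReal_ofNat]
  linarith

/-- The strings of length `M`. -/
def stringsOfLength (M : ℕ) : Finset (List Bool) :=
  Finset.univ.image (List.ofFn : (Fin M → Bool) → List Bool)

theorem initSeg_mem_stringsOfLength (X : Cantor) (M : ℕ) : initSeg X M ∈ stringsOfLength M := by
  refine Finset.mem_image.2 ⟨fun i => X i, Finset.mem_univ _, ?_⟩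
  refine List.ext_getElem (by simp) fun i h1 h2 => ?_
  simp [initSeg]

theorem length_of_mem_stringsOfLength {M : ℕ} {σ : List Bool} (h : σ ∈ stringsOfLength M) :
    σ.length = M := by
  obtain ⟨g, -, rfl⟩ := Finset.mem_image.1 h
  simp

theorem exists_isCertificate [Countable β] {f : β → List Bool} {p : ℕ × ℕ} {S : ℝ≥0∞}
    (hS : ∑' x : {x // W x}, 2⁻¹ ^ (f x.1).length = S) (hfin : S ≠ ∞)
    (h : lebesgue ((⋃ x : {x // W x}, cyl (f x.1)) ∪ lexBelow p.1 p.2) < 1 / 2) :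
    ∃ c, IsCertificate f p c ∧ (∀ x ∈ c.1.1, W x) ∧ 0 < c.2.2.2 ∧ S * c.2.2.2 < c.2.2.1 := by
  classical
  obtain ⟨m, k⟩ := p
  dsimp only at h
  set V := (⋃ x : {x // W x}, cyl (f x.1)) ∪ lexBelow m k with hV
  set v := (lebesgue V).toReal with hv
  have hvlt : v < 1 / 2 := by
    have := (ENNReal.toReal_lt_toReal (by simp) (by simp)).2 h
    simpa using this
  set s := S.toReal with hs
  -- Half of the available slack pays for the rational bound `r < s + δ`, the other half for the
  -- weight of `F`, which exceeds `s - δ`.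
  set δ := (1 / 2 - v) / 2 with hδ
  have hδpos : 0 < δ := by rw [hδ]; linarith
  obtain ⟨r, hr1, hr2⟩ := exists_rat_btwn (show s < s + δ by linarith)
  have hr0 : 0 < r := by
    have : (0 : ℝ) < r := lt_of_le_of_lt ENNReal.toReal_nonneg hr1
    exact_mod_cast this
  have hrnum := ratCast_eq_toNat_div hr0
  have hsum : HasSum (fun x : {x // W x} => (2⁻¹ : ℝ) ^ (f x.1).length) s := by
    have h3 := (ENNReal.hasSum_toReal (f := fun x : {x // W x} => (2⁻¹ : ℝ≥0∞) ^ (f x.1).length)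
      (by rw [hS]; exact hfin))
    rw [hs, ← hS, ENNReal.tsum_toReal_eq fun x => by simp]
    simpa only [toReal_two_inv_pow] using h3
  obtain ⟨F, hF⟩ : ∃ F : Finset {x // W x}, s - δ < ∑ x ∈ F, (2⁻¹ : ℝ) ^ (f x.1).length :=
    (hsum.eventually (lt_mem_nhds (show s - δ < s by linarith))).exists
  let E : List β := F.toList.map Subtype.val
  have hEW : ∀ x ∈ E, W x := fun x hx => by
    obtain ⟨i, -, rfl⟩ := List.mem_map.1 hx
    exact i.2
  have hEn : E.Nodup := List.Nodup.map Subtype.val_injective F.nodup_toList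
  have hEsum : (E.map fun x => (2⁻¹ : ℝ) ^ (f x).length).sum =
      ∑ x ∈ F, (2⁻¹ : ℝ) ^ (f x.1).length := by
    rw [List.map_map, ← Finset.sum_map_toList]
    rfl
  let M := m + F.sum fun x => (f x.1).length
  have hEM : ∀ x ∈ E, (f x).length ≤ M := fun x hx => by
    obtain ⟨i, hi, rfl⟩ := List.mem_map.1 hx
    exact (Finset.single_le_sum (f := fun x : {x // W x} => (f x.1).length)
      (fun _ _ => Nat.zero_le _) (by simpa using hi)).trans (Nat.le_add_left _ _)
  -- All strings of length `M` off the finite part; `M` is at least `m` and every length in `E`, so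
  -- `M` letters decide membership in that part.
  let G : Finset (List Bool) := (stringsOfLength M).filter fun τ =>
    ¬ binVal (τ.take m) < k ∧ ∀ x ∈ E, ¬ f x <+: τ
  have hcover : (Set.univ : Set Cantor) ⊆ openSet (G : Set (List Bool)) ∪ V := by
    intro X _
    by_cases hX : initSeg X M ∈ G
    · exact Or.inl (mem_openSet.2 ⟨M, hX⟩)
    · refine Or.inr ?_
      rw [Finset.mem_filter, not_and, not_and_or, not_not] at hX
      rcases hX (initSeg_mem_stringsOfLength X M) with h3 | h3
      · rw [take_initSeg X (Nat.le_add_right _ _)] at h3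
        exact Or.inr h3
      · push Not at h3
        obtain ⟨x, hx, h4⟩ := h3
        exact Or.inl (Set.mem_iUnion.2 ⟨⟨x, hEW x hx⟩, (prefix_initSeg_iff.1 h4).2⟩)
  have hG : 1 ≤ (G.card : ℝ) * 2⁻¹ ^ M + v := by
    have h3 := (measure_mono hcover).trans (measure_union_le (μ := lebesgue) _ _)
    rw [measure_univ, lebesgue_openSet_finset (M := M) fun τ hτ =>
      length_of_mem_stringsOfLength (Finset.mem_filter.1 hτ).1] at h3
    have h4 := ENNReal.toReal_mono (ENNReal.add_ne_top.2
      ⟨ENNReal.mul_ne_top (by simp) (by simp), by simp⟩) h3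
    rwa [ENNReal.toReal_add (ENNReal.mul_ne_top (by simp) (by simp)) (by simp),
      ENNReal.toReal_mul, toReal_two_inv_pow, ENNReal.toReal_natCast,
      ENNReal.toReal_one] at h4
  refine ⟨((E, G.toList), M, r.num.toNat, r.den), ⟨⟨hEn, G.nodup_toList, Nat.le_add_right _ _⟩,
    hEM, fun τ hτ => ?_, ?_⟩, hEW, r.den_pos, ?_⟩
  · have h3 := Finset.mem_filter.1 (Finset.mem_toList.1 hτ)
    exact ⟨⟨length_of_mem_stringsOfLength h3.1, h3.2.1⟩, h3.2.2⟩
  · rw [certificate_inequality_iff _ r.den_pos hEM, hEsum, ← hrnum, Finset.length_toList]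
    linarith
  · rw [← ENNReal.toReal_lt_toReal (ENNReal.mul_ne_top hfin (by simp)) (by simp)]
    simp only [ENNReal.toReal_mul, ENNReal.toReal_natCast]
    rw [← lt_div_iff₀ (by exact_mod_cast r.den_pos), ← hrnum]
    exact hr1

/-- A c.e. family of cylinders whose total weight is at most one half and approximable from above
is covered by a c.e. open set of measure exactly one half. -/
theorem exists_prefixFree_half [Primcodable β] {A : Cantor} (hW : CE A W) {f : β → List Bool}
    (hf : Primrec f) {S : ℝ≥0∞} (hS : ∑' x : {x // W x}, 2⁻¹ ^ (f x.1).length = S)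
    (hle : S ≤ 1 / 2) (hup : CE A fun p : ℕ × ℕ => 0 < p.2 ∧ S * p.2 < p.1) :
    ∃ U : Set (List Bool), PrefixFree U ∧ CE A (fun σ => σ ∈ U) ∧
      (∀ x, W x → cyl (f x) ⊆ openSet U) ∧ lebesgue (openSet U) = 1 / 2 := by
  have : Countable β := (Encodable.encode_injective (α := β)).countable
  have hfin : S ≠ ∞ := ne_top_of_le_ne_top (by simp) hle
  let V : Set Cantor := ⋃ x : {x // W x}, cyl (f x.1)
  have hgood : CE A fun p : ℕ × ℕ => lebesgue (V ∪ lexBelow p.1 p.2) < 1 / 2 := by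
    have h1 : CE A fun p : ℕ × ℕ => ∃ c : (List β × List (List Bool)) × (ℕ × ℕ × ℕ),
        IsCertificate f p c ∧ (∀ x ∈ c.1.1, W x) ∧ 0 < c.2.2.2 ∧ S * c.2.2.2 < c.2.2.1 := by
      refine CE.exists (S := fun (p : ℕ × ℕ) (c : (List β × List (List Bool)) × (ℕ × ℕ × ℕ)) =>
        IsCertificate f p c ∧ (∀ x ∈ c.1.1, W x) ∧ 0 < c.2.2.2 ∧ S * c.2.2.2 < c.2.2.1) ?_
      refine (CE.of_primrec (primrecRel_isCertificate hf)).and (CE.and ?_ ?_)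
      · exact (CE.forall_mem (S := fun (_ : Unit) x => W x) (hW.comp Primrec.snd)).comp
          (Primrec.pair (Primrec.const ())
            (Primrec.fst.comp (Primrec.fst.comp Primrec.snd)))
      · exact hup.comp (Primrec.snd.comp (Primrec.snd.comp Primrec.snd))
    refine h1.of_eq fun p => ⟨?_, exists_isCertificate hS hfin⟩
    rintro ⟨c, h1, h2, h3, h4⟩
    exact h1.lebesgue_lt h2 h3 hS h4
  -- Besides the given strings, `D` takes each `σ` whose cylinder lies to the left of a dyadic point
  -- up to which filling stays below `1 / 2`.
  let D : List Bool → Prop := fun σ => (∃ x, W x ∧ f x = σ) ∨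
    ∃ k, binVal σ < k ∧ lebesgue (V ∪ lexBelow σ.length k) < 1 / 2
  have hD : CE A D := by
    refine CE.or ?_ ?_
    · exact CE.exists (S := fun (σ : List Bool) x => W x ∧ f x = σ)
        ((hW.comp Primrec.snd).and (CE.of_primrec
          (PrimrecRel.comp Primrec.eq (hf.comp Primrec.snd) Primrec.fst)))
    · exact CE.exists (S := fun (σ : List Bool) k => binVal σ < k ∧
        lebesgue (V ∪ lexBelow σ.length k) < 1 / 2)
        ((CE.of_primrec (Primrec.nat_lt.comp (primrec_binVal.comp Primrec.fst) Primrec.snd)).and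
          (hgood.comp (Primrec.pair (Primrec.list_length.comp Primrec.fst) Primrec.snd)))
  obtain ⟨U, hU, hUce, hUD⟩ := hD.exists_prefixFree
  have hDV : openSet {σ | D σ} = V ∪ ⋃ p : {p : ℕ × ℕ // lebesgue (V ∪ lexBelow p.1 p.2) < 1 / 2},
      lexBelow p.1.1 p.1.2 := by
    ext X
    rw [mem_openSet]
    constructor
    · rintro ⟨n, ⟨x, hx, h⟩ | ⟨k, hk, h⟩⟩
      · refine Or.inl (Set.mem_iUnion.2 ⟨⟨x, hx⟩, ?_⟩)
        rw [mem_cyl, h, length_initSeg]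
      · rw [length_initSeg] at h
        exact Or.inr (Set.mem_iUnion.2 ⟨⟨(n, k), h⟩, hk⟩)
    · rintro (h | h)
      · obtain ⟨x, hx⟩ := Set.mem_iUnion.1 h
        exact ⟨_, Or.inl ⟨x.1, x.2, (mem_cyl.1 hx).symm⟩⟩
      · obtain ⟨⟨⟨n, k⟩, h1⟩, hx⟩ := Set.mem_iUnion.1 h
        exact ⟨n, Or.inr ⟨k, hx, by rwa [length_initSeg]⟩⟩
  refine ⟨U, hU, hUce, fun x hx => ?_, ?_⟩
  · rw [hUD, hDV]
    exact (Set.subset_iUnion (fun x : {x // W x} => cyl (f x.1)) ⟨x, hx⟩).trans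
      Set.subset_union_left
  · rw [hUD, hDV]
    refine lebesgue_fill ?_ (by simp)
    refine (measure_iUnion_le _).trans (le_trans (le_of_eq ?_) hle)
    rw [← hS]
    exact tsum_congr fun x => lebesgue_cyl _

end Padding
-- Computable rational-valued functions
section RatComp
variable {α β : Type} [Primcodable α] [Primcodable β]

theorem computableIn_empty_iff {f : α → β} : ComputableIn ∅ f ↔ Computable f :=
  recursiveIn_empty_iff

/-- The rational number coded by a triple of natural numbers. -/
def ratOfCode (c : ℕ × ℕ × ℕ) : ℚ := ((c.1 : ℚ) - c.2.1) / (c.2.2 + 1)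

/-- Addition of codes of rational numbers. -/
def addCode (c e : ℕ × ℕ × ℕ) : ℕ × ℕ × ℕ :=
  (c.1 * (e.2.2 + 1) + e.1 * (c.2.2 + 1), c.2.1 * (e.2.2 + 1) + e.2.1 * (c.2.2 + 1),
    c.2.2 * e.2.2 + c.2.2 + e.2.2)

/-- Multiplication of codes of rational numbers. -/
def mulCode (c e : ℕ × ℕ × ℕ) : ℕ × ℕ × ℕ :=
  (c.1 * e.1 + c.2.1 * e.2.1, c.1 * e.2.1 + c.2.1 * e.1, c.2.2 * e.2.2 + c.2.2 + e.2.2)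

theorem ratOfCode_addCode (c e : ℕ × ℕ × ℕ) :
    ratOfCode (addCode c e) = ratOfCode c + ratOfCode e := by
  simp only [ratOfCode, addCode]
  push_cast
  rw [div_add_div _ _ (by positivity) (by positivity)]
  congr 1 <;> ring

theorem ratOfCode_mulCode (c e : ℕ × ℕ × ℕ) :
    ratOfCode (mulCode c e) = ratOfCode c * ratOfCode e := by
  simp only [ratOfCode, mulCode]
  push_cast
  rw [div_mul_div_comm]
  congr 1 <;> ring

theorem exists_ratOfCode_eq (q : ℚ) : ∃ c, ratOfCode c = q := by
  refine ⟨(q.num.toNat, (-q.num).toNat, q.den - 1), ?_⟩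
  have h1 : ((q.den - 1 : ℕ) : ℚ) + 1 = q.den := by
    rw [Nat.cast_sub q.den_pos]
    simp
  have h2 : ((q.num.toNat : ℚ)) - ((-q.num).toNat : ℚ) = q.num := by
    have := Int.toNat_sub_toNat_neg q.num
    exact_mod_cast congrArg (fun z : ℤ => (z : ℚ)) this
  simp only [ratOfCode]
  rw [h1, h2, Rat.num_div_den]

theorem ratOfCode_le_iff (c e : ℕ × ℕ × ℕ) : ratOfCode c ≤ ratOfCode e ↔
    c.1 * (e.2.2 + 1) + e.2.1 * (c.2.2 + 1) ≤ e.1 * (c.2.2 + 1) + c.2.1 * (e.2.2 + 1) := by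
  simp only [ratOfCode]
  rw [div_le_div_iff₀ (by positivity) (by positivity), ← Nat.cast_le (α := ℚ)]
  push_cast
  constructor <;> intro h <;> linarith

theorem primrec_addCode : Primrec₂ addCode := by
  have h1 : ∀ {w : (ℕ × ℕ × ℕ) × (ℕ × ℕ × ℕ) → ℕ}, Primrec w → Primrec fun x => w x + 1 :=
    fun hw => Primrec.succ.comp hw
  have a1 : Primrec fun x : (ℕ × ℕ × ℕ) × (ℕ × ℕ × ℕ) => x.1.1 := Primrec.fst.comp Primrec.fst
  have a2 : Primrec fun x : (ℕ × ℕ × ℕ) × (ℕ × ℕ × ℕ) => x.1.2.1 :=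
    Primrec.fst.comp (Primrec.snd.comp Primrec.fst)
  have a3 : Primrec fun x : (ℕ × ℕ × ℕ) × (ℕ × ℕ × ℕ) => x.1.2.2 :=
    Primrec.snd.comp (Primrec.snd.comp Primrec.fst)
  have b1 : Primrec fun x : (ℕ × ℕ × ℕ) × (ℕ × ℕ × ℕ) => x.2.1 := Primrec.fst.comp Primrec.snd
  have b2 : Primrec fun x : (ℕ × ℕ × ℕ) × (ℕ × ℕ × ℕ) => x.2.2.1 :=
    Primrec.fst.comp (Primrec.snd.comp Primrec.snd)
  have b3 : Primrec fun x : (ℕ × ℕ × ℕ) × (ℕ × ℕ × ℕ) => x.2.2.2 :=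
    Primrec.snd.comp (Primrec.snd.comp Primrec.snd)
  exact Primrec.pair (Primrec.nat_add.comp (Primrec.nat_mul.comp a1 (h1 b3))
    (Primrec.nat_mul.comp b1 (h1 a3))) (Primrec.pair (Primrec.nat_add.comp
      (Primrec.nat_mul.comp a2 (h1 b3)) (Primrec.nat_mul.comp b2 (h1 a3)))
      (Primrec.nat_add.comp (Primrec.nat_add.comp (Primrec.nat_mul.comp a3 b3) a3) b3))

theorem primrec_mulCode : Primrec₂ mulCode := by
  have a1 : Primrec fun x : (ℕ × ℕ × ℕ) × (ℕ × ℕ × ℕ) => x.1.1 := Primrec.fst.comp Primrec.fst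
  have a2 : Primrec fun x : (ℕ × ℕ × ℕ) × (ℕ × ℕ × ℕ) => x.1.2.1 :=
    Primrec.fst.comp (Primrec.snd.comp Primrec.fst)
  have a3 : Primrec fun x : (ℕ × ℕ × ℕ) × (ℕ × ℕ × ℕ) => x.1.2.2 :=
    Primrec.snd.comp (Primrec.snd.comp Primrec.fst)
  have b1 : Primrec fun x : (ℕ × ℕ × ℕ) × (ℕ × ℕ × ℕ) => x.2.1 := Primrec.fst.comp Primrec.snd
  have b2 : Primrec fun x : (ℕ × ℕ × ℕ) × (ℕ × ℕ × ℕ) => x.2.2.1 :=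
    Primrec.fst.comp (Primrec.snd.comp Primrec.snd)
  have b3 : Primrec fun x : (ℕ × ℕ × ℕ) × (ℕ × ℕ × ℕ) => x.2.2.2 :=
    Primrec.snd.comp (Primrec.snd.comp Primrec.snd)
  exact Primrec.pair (Primrec.nat_add.comp (Primrec.nat_mul.comp a1 b1)
    (Primrec.nat_mul.comp a2 b2)) (Primrec.pair (Primrec.nat_add.comp
      (Primrec.nat_mul.comp a1 b2) (Primrec.nat_mul.comp a2 b1))
      (Primrec.nat_add.comp (Primrec.nat_add.comp (Primrec.nat_mul.comp a3 b3) a3) b3))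

theorem primrecRel_ratOfCode_le : PrimrecRel fun c e => ratOfCode c ≤ ratOfCode e := by
  have h1 : ∀ {w : (ℕ × ℕ × ℕ) × (ℕ × ℕ × ℕ) → ℕ}, Primrec w → Primrec fun x => w x + 1 :=
    fun hw => Primrec.succ.comp hw
  have a1 : Primrec fun x : (ℕ × ℕ × ℕ) × (ℕ × ℕ × ℕ) => x.1.1 := Primrec.fst.comp Primrec.fst
  have a2 : Primrec fun x : (ℕ × ℕ × ℕ) × (ℕ × ℕ × ℕ) => x.1.2.1 :=
    Primrec.fst.comp (Primrec.snd.comp Primrec.fst)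
  have a3 : Primrec fun x : (ℕ × ℕ × ℕ) × (ℕ × ℕ × ℕ) => x.1.2.2 :=
    Primrec.snd.comp (Primrec.snd.comp Primrec.fst)
  have b1 : Primrec fun x : (ℕ × ℕ × ℕ) × (ℕ × ℕ × ℕ) => x.2.1 := Primrec.fst.comp Primrec.snd
  have b2 : Primrec fun x : (ℕ × ℕ × ℕ) × (ℕ × ℕ × ℕ) => x.2.2.1 :=
    Primrec.fst.comp (Primrec.snd.comp Primrec.snd)
  have b3 : Primrec fun x : (ℕ × ℕ × ℕ) × (ℕ × ℕ × ℕ) => x.2.2.2 :=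
    Primrec.snd.comp (Primrec.snd.comp Primrec.snd)
  exact (Primrec.nat_le.comp (Primrec.nat_add.comp (Primrec.nat_mul.comp a1 (h1 b3))
    (Primrec.nat_mul.comp b2 (h1 a3))) (Primrec.nat_add.comp (Primrec.nat_mul.comp b1 (h1 a3))
      (Primrec.nat_mul.comp a2 (h1 b3)))).of_eq fun x => (ratOfCode_le_iff x.1 x.2).symm

/-- `f` is computable as a function into the rationals. -/
def RatComp (f : α → ℚ) : Prop := ∃ c : α → ℕ × ℕ × ℕ, Computable c ∧ ∀ a, f a = ratOfCode (c a)

theorem ratComp_iff {f : α → ℚ} : RatComp f ↔ RatComputableIn ∅ f := by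
  constructor
  · rintro ⟨c, hc, h⟩
    refine ⟨fun a => (c a).1, fun a => (c a).2.1, fun a => (c a).2.2 + 1,
      computableIn_empty_iff.2 (Computable.fst.comp hc),
      computableIn_empty_iff.2 (Computable.fst.comp (Computable.snd.comp hc)),
      computableIn_empty_iff.2 (Computable.succ.comp (Computable.snd.comp (Computable.snd.comp hc))),
      fun a => ⟨Nat.succ_ne_zero _, ?_⟩⟩
    rw [h, ratOfCode]
    push_cast
    rfl
  · rintro ⟨p, m, d, hp, hm, hd, h⟩
    rw [computableIn_empty_iff] at hp hm hd
    refine ⟨fun a => (p a, m a, d a - 1), hp.pair (hm.pair (Computable.pred.comp hd)), fun a => ?_⟩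
    rw [(h a).2, ratOfCode, Nat.cast_sub (Nat.one_le_iff_ne_zero.2 (h a).1)]
    simp

theorem RatComp.const (q : ℚ) : RatComp fun _ : α => q := by
  obtain ⟨c, rfl⟩ := exists_ratOfCode_eq q
  exact ⟨fun _ => c, Computable.const c, fun _ => rfl⟩

theorem RatComp.add {f g : α → ℚ} (hf : RatComp f) (hg : RatComp g) :
    RatComp fun a => f a + g a := by
  obtain ⟨c, hc, h⟩ := hf
  obtain ⟨e, he, h'⟩ := hg
  exact ⟨fun a => addCode (c a) (e a), primrec_addCode.to_comp.comp hc he, fun a => by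
    simp only [h, h', ratOfCode_addCode]⟩

theorem RatComp.mul {f g : α → ℚ} (hf : RatComp f) (hg : RatComp g) :
    RatComp fun a => f a * g a := by
  obtain ⟨c, hc, h⟩ := hf
  obtain ⟨e, he, h'⟩ := hg
  exact ⟨fun a => mulCode (c a) (e a), primrec_mulCode.to_comp.comp hc he, fun a => by
    simp only [h, h', ratOfCode_mulCode]⟩

theorem RatComp.comp {f : β → ℚ} (hf : RatComp f) {g : α → β} (hg : Computable g) :
    RatComp fun a => f (g a) := by
  obtain ⟨c, hc, h⟩ := hf
  exact ⟨fun a => c (g a), hc.comp hg, fun a => h _⟩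

theorem Computable.list_foldl {step : β → Bool → β} (hstep : Computable₂ step) (s : β) :
    Computable fun l : List Bool => l.foldl step s := by
  have h1 : Computable fun l : List Bool => (Nat.rec s
      (fun n IH => step IH (l.getD n false)) l.length : β) :=
    Computable.nat_rec (h := fun (l : List Bool) (x : ℕ × β) => step x.2 (l.getD x.1 false))
      Computable.list_length (Computable.const s)
      (hstep.comp (Computable.snd.comp Computable.snd)
        ((Primrec.list_getD false).to_comp.comp Computable.fst
          (Computable.fst.comp Computable.snd)))
  refine h1.of_eq fun l => ?_
  have h2 : ∀ n ≤ l.length, (Nat.rec s (fun n IH => step IH (l.getD n false)) n : β) =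
      (l.take n).foldl step s := by
    intro n hn
    induction n with
    | zero => rfl
    | succ n ih =>
      refine (congrArg (step · (l.getD n false)) (ih (by omega))).trans ?_
      rw [List.take_succ_eq_append_getElem (by omega), List.foldl_append]
      simp [List.getD, List.getElem?_eq_getElem (show n < l.length by omega)]
  rw [h2 _ le_rfl, List.take_length]

/-- A computable code function is determined by the partial recursive function on numbers that it
induces, and there are only countably many programs. -/
theorem countable_setOf_ratComp : {f : α → ℚ | RatComp f}.Countable := by
  have h1 : {c : α → ℕ × ℕ × ℕ | Computable c}.Countable := by
    have h2 : Set.InjOn (fun c : α → ℕ × ℕ × ℕ => fun n : ℕ =>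
        Part.bind (Encodable.decode (α := α) n : Part α) fun a =>
          (Part.some (c a)).map Encodable.encode)
        {c : α → ℕ × ℕ × ℕ | Computable c} := by
      intro c _ e _ h
      funext a
      have h3 := congrFun h (Encodable.encode a)
      simpa using h3
    refine Set.MapsTo.countable_of_injOn (t := Set.range Nat.Partrec.Code.eval) ?_ h2
      (Set.countable_range _)
    intro c hc
    exact Nat.Partrec.Code.exists_code.1 hc
  refine (h1.image fun c a => ratOfCode (c a)).mono ?_
  rintro f ⟨c, hc, h⟩
  exact ⟨c, hc, (funext h).symm⟩

end RatComp

/-! ### Rational domination and restarting of martingales -/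

section Martingales

/-- Rational-valued martingales. -/
def IsRatMartingale (d : List Bool → ℚ) : Prop :=
  (∀ σ, 0 ≤ d σ) ∧ ∀ σ, d σ = (d (σ ++ [false]) + d (σ ++ [true])) / 2

theorem isRatMartingale_iff {d : List Bool → ℚ} :
    IsRatMartingale d ↔ IsMartingale fun σ => (d σ : ℝ) := by
  refine and_congr (forall_congr' fun σ => ?_) (forall_congr' fun σ => ?_)
  · exact Rat.cast_nonneg.symm
  · rw [← Rat.cast_inj (α := ℝ)]
    push_cast
    rfl

theorem IsRatMartingale.add {d e : List Bool → ℚ} (hd : IsRatMartingale d)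
    (he : IsRatMartingale e) : IsRatMartingale fun σ => d σ + e σ :=
  ⟨fun σ => add_nonneg (hd.1 σ) (he.1 σ), fun σ => by dsimp only; rw [hd.2 σ, he.2 σ]; ring⟩

theorem IsRatMartingale.const_mul {d : List Bool → ℚ} (hd : IsRatMartingale d) {c : ℚ}
    (hc : 0 ≤ c) : IsRatMartingale fun σ => c * d σ :=
  ⟨fun σ => mul_nonneg hc (hd.1 σ), fun σ => by dsimp only; rw [hd.2 σ]; ring⟩

theorem IsRatMartingale.append {d : List Bool → ℚ} (hd : IsRatMartingale d) (ρ : List Bool) :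
    IsRatMartingale fun σ => d (ρ ++ σ) :=
  ⟨fun σ => hd.1 _, fun σ => by dsimp only; rw [hd.2 (ρ ++ σ)]; simp⟩

theorem RatComp.append {d : List Bool → ℚ} (hd : RatComp d) (ρ : List Bool) :
    RatComp fun σ => d (ρ ++ σ) :=
  hd.comp (Computable.list_append.comp (Computable.const ρ) Computable.id)

/-- A computable real-valued martingale is dominated by a computable rational-valued one. -/
theorem exists_ratMartingale_ge {d : List Bool → ℝ} (hd : IsMartingale d)
    (hc : RealFunComputableIn ∅ d) :
    ∃ B : List Bool → ℚ, IsRatMartingale B ∧ RatComp B ∧ ∀ σ, d σ ≤ B σ := by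
  obtain ⟨g, hg, happ⟩ := hc
  rw [← ratComp_iff] at hg
  -- The increments towards the two children are opposite, so fairness is exact whatever the error
  -- of `g`. Each increment is off from that of `d` by at most `2⁻¹ ^ (x.1.length + 2)`.
  let s : List Bool × Bool → ℚ := fun x => (if x.2 then -1 else 1) *
    ((1 / 2) * (g (x.1 ++ [false], x.1.length + 2) + -1 * g (x.1 ++ [true], x.1.length + 2)))
  have hs : RatComp s := by
    refine RatComp.mul ?_ ((RatComp.const _).mul (RatComp.add ?_ ((RatComp.const _).mul ?_)))
    · obtain ⟨c, hc⟩ := exists_ratOfCode_eq (-1)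
      obtain ⟨e, he⟩ := exists_ratOfCode_eq 1
      refine ⟨fun x => bif x.2 then c else e, (Primrec.cond Primrec.snd (Primrec.const c)
        (Primrec.const e)).to_comp, ?_⟩
      rintro ⟨τ, _ | _⟩ <;> simp [hc, he]
    · exact hg.comp ((Computable.list_concat.comp Computable.fst (Computable.const false)).pair
        (Computable.succ.comp (Computable.succ.comp (Computable.list_length.comp Computable.fst))))
    · exact hg.comp ((Computable.list_concat.comp Computable.fst (Computable.const true)).pair
        (Computable.succ.comp (Computable.succ.comp (Computable.list_length.comp Computable.fst))))
  obtain ⟨c, hcc, hcs⟩ := hs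
  obtain ⟨c₀, hc₀⟩ := exists_ratOfCode_eq (g ([], 0) + 3)
  let step : List Bool × (ℕ × ℕ × ℕ) → Bool → List Bool × (ℕ × ℕ × ℕ) := fun x b =>
    (x.1 ++ [b], addCode x.2 (c (x.1, b)))
  have hstep : Computable₂ step :=
    (Computable.list_concat.comp (Computable.fst.comp Computable.fst) Computable.snd).pair
      (primrec_addCode.to_comp.comp (Computable.snd.comp Computable.fst)
        (hcc.comp ((Computable.fst.comp Computable.fst).pair Computable.snd)))
  let F : List Bool → List Bool × (ℕ × ℕ × ℕ) := fun σ => σ.foldl step ([], c₀)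
  have hF : Computable F := Computable.list_foldl hstep _
  have hFc : ∀ σ b, F (σ ++ [b]) = step (F σ) b := fun σ b => by simp [F]
  have hF1 : ∀ σ, (F σ).1 = σ := fun σ => by
    induction σ using List.reverseRecOn with
    | nil => rfl
    | append_singleton σ b ih => rw [hFc]; simp [step, ih]
  let B : List Bool → ℚ := fun σ => ratOfCode (F σ).2
  have hB0 : B [] = g ([], 0) + 3 := hc₀
  have hBc : ∀ σ b, B (σ ++ [b]) = B σ + s (σ, b) := fun σ b => by
    simp only [B, hFc, step, ratOfCode_addCode, hF1, ← hcs]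
  have hBcomp : RatComp B := ⟨fun σ => (F σ).2, Computable.snd.comp hF, fun _ => rfl⟩
  -- The margin `2⁻¹ ^ σ.length` shrinks by half of itself at each letter, which is more than the
  -- error of one increment. At the root, `g ([], 0) + 3` is at least `d [] + 2`.
  have hlow : ∀ σ, d σ + 1 + 2⁻¹ ^ σ.length ≤ B σ := by
    intro σ
    induction σ using List.reverseRecOn with
    | nil =>
      have h1 := abs_le.1 (happ [] 0)
      rw [hB0]
      push_cast
      simp only [List.length_nil, pow_zero] at h1 ⊢
      linarith [h1.1]
    | append_singleton σ b ih =>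
      have h1 := abs_le.1 (happ (σ ++ [false]) (σ.length + 2))
      have h2 := abs_le.1 (happ (σ ++ [true]) (σ.length + 2))
      have h3 := hd.2 σ
      have h4 : (0 : ℝ) < 2⁻¹ ^ σ.length := by positivity
      rw [hBc]
      simp only [s]
      simp only [List.length_append, List.length_singleton, pow_succ] at h1 h2 ⊢
      cases b
      · push_cast
        norm_num at h1 h2 ⊢
        linarith [h1.1, h2.2]
      · push_cast
        norm_num at h1 h2 ⊢
        linarith [h1.2, h2.1]
  refine ⟨B, ⟨fun σ => ?_, fun σ => ?_⟩, hBcomp, fun σ => ?_⟩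
  · have h1 := hlow σ
    have h2 := hd.1 σ
    have h3 : (0 : ℝ) < 2⁻¹ ^ σ.length := by positivity
    have : (0 : ℝ) ≤ B σ := by linarith
    exact_mod_cast this
  · rw [hBc, hBc]
    simp only [s]
    norm_num
    ring
  · have h1 := hlow σ
    have h3 : (0 : ℝ) < 2⁻¹ ^ σ.length := by positivity
    linarith

/-- A computable martingale with `d [] = 1` that is restarted whenever it reaches `q`. -/
theorem exists_restart {d : List Bool → ℚ} (hd : IsRatMartingale d) (hc : RatComp d)
    (h1 : d [] = 1) {q : ℚ} (hq : 1 < q) :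
    ∃ D : List Bool → ℚ, IsRatMartingale D ∧ RatComp D ∧
      ∀ X : Cantor, (∀ n, (fun i => X (n + i)) ∈ openSet (minimalReaching d q)) →
        ∀ k : ℕ, ∃ n, k ≤ n ∧ q ^ k ≤ D (initSeg X n) := by
  obtain ⟨c, hcc, hcd⟩ := hc
  obtain ⟨c₁, hc₁⟩ := exists_ratOfCode_eq 1
  obtain ⟨cq, hcq⟩ := exists_ratOfCode_eq q
  classical
  -- A state holds the letters read since the last restart and the code of the capital at that
  -- restart.
  let step : List Bool × (ℕ × ℕ × ℕ) → Bool → List Bool × (ℕ × ℕ × ℕ) := fun x b =>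
    bif decide (ratOfCode cq ≤ ratOfCode (c (x.1 ++ [b]))) then
      ([], mulCode x.2 (c (x.1 ++ [b]))) else (x.1 ++ [b], x.2)
  have hcon : Computable fun p : (List Bool × (ℕ × ℕ × ℕ)) × Bool => p.1.1 ++ [p.2] :=
    Computable.list_concat.comp (Computable.fst.comp Computable.fst) Computable.snd
  have hstep : Computable₂ step :=
    Computable.cond (primrecRel_ratOfCode_le.decide.to_comp.comp (Computable.const cq)
        (hcc.comp hcon))
      ((Computable.const []).pair (primrec_mulCode.to_comp.comp
        (Computable.snd.comp Computable.fst) (hcc.comp hcon)))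
      (hcon.pair (Computable.snd.comp Computable.fst))
  let F : List Bool → List Bool × (ℕ × ℕ × ℕ) := fun σ => σ.foldl step ([], c₁)
  have hF : Computable F := Computable.list_foldl hstep _
  have hFc : ∀ σ b, F (σ ++ [b]) = step (F σ) b := fun σ b => by simp [F]
  have hstep1 : ∀ x b, q ≤ d (x.1 ++ [b]) → step x b = ([], mulCode x.2 (c (x.1 ++ [b]))) := by
    intro x b h
    simp only [step, hcq, ← hcd, h, decide_true, cond_true]
  have hstep2 : ∀ x b, ¬ q ≤ d (x.1 ++ [b]) → step x b = (x.1 ++ [b], x.2) := by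
    intro x b h
    simp only [step, hcq, ← hcd, h, decide_false, cond_false]
  let D : List Bool → ℚ := fun σ => ratOfCode (F σ).2 * d (F σ).1
  -- A restart does not change the current capital, because `d [] = 1`; fairness of `D` is therefore
  -- inherited from `d`.
  have hDc : ∀ σ b, D (σ ++ [b]) = ratOfCode (F σ).2 * d ((F σ).1 ++ [b]) := by
    intro σ b
    simp only [D, hFc]
    by_cases h : q ≤ d ((F σ).1 ++ [b])
    · rw [hstep1 _ _ h, ratOfCode_mulCode, h1, mul_one, ← hcd]
    · rw [hstep2 _ _ h]
  have hpos : ∀ σ, 0 ≤ ratOfCode (F σ).2 := by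
    intro σ
    induction σ using List.reverseRecOn with
    | nil => simp [F, hc₁]
    | append_singleton σ b ih =>
      rw [hFc]
      by_cases h : q ≤ d ((F σ).1 ++ [b])
      · rw [hstep1 _ _ h, ratOfCode_mulCode, ← hcd]
        exact mul_nonneg ih (hd.1 _)
      · rwa [hstep2 _ _ h]
  have hrun : ∀ (ρ τ : List Bool), (F ρ).1 = [] → (∀ κ, κ <+: τ → ¬ q ≤ d κ) →
      F (ρ ++ τ) = (τ, (F ρ).2) := by
    intro ρ τ hρ hτ
    induction τ using List.reverseRecOn with
    | nil => rw [List.append_nil, ← hρ]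
    | append_singleton τ b ih =>
      rw [← List.append_assoc, hFc, ih fun κ hκ => hτ κ (hκ.trans (List.prefix_append _ _)),
        hstep2 _ _ (hτ _ List.prefix_rfl)]
  refine ⟨D, ⟨fun σ => mul_nonneg (hpos σ) (hd.1 _), fun σ => ?_⟩, ?_, fun X hX k => ?_⟩
  · rw [hDc, hDc]
    simp only [D]
    rw [hd.2 (F σ).1]
    ring
  · exact RatComp.mul ⟨fun σ => (F σ).2, Computable.snd.comp hF, fun _ => rfl⟩
      (RatComp.comp ⟨c, hcc, hcd⟩ (Computable.fst.comp hF))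
  -- The induction runs over positions just after a restart: from there the remaining tail of `X`
  -- meets `minimalReaching d q`, and no restart occurs before that point.
  · suffices h : ∃ n, k ≤ n ∧ (F (initSeg X n)).1 = [] ∧ q ^ k ≤ ratOfCode (F (initSeg X n)).2 by
      obtain ⟨n, h2, h3, h4⟩ := h
      refine ⟨n, h2, ?_⟩
      simp only [D]
      rwa [h3, h1, mul_one]
    induction k with
    | zero => exact ⟨0, le_rfl, rfl, by simp [F, hc₁]⟩
    | succ k ih =>
      obtain ⟨n, h2, h3, h4⟩ := ih
      obtain ⟨m, hm, hmin⟩ := mem_openSet.1 (hX n)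
      have hm0 : m ≠ 0 := by
        rintro rfl
        rw [initSeg_zero, h1] at hm
        linarith
      obtain ⟨m, rfl⟩ := Nat.exists_eq_succ_of_ne_zero hm0
      have happ : ∀ j, initSeg X (n + j) = initSeg X n ++ initSeg (fun i => X (n + i)) j := by
        intro j
        induction j with
        | zero => simp
        | succ j ih => rw [← add_assoc, initSeg_succ, ih, initSeg_succ, List.append_assoc]
      have hrun' := hrun (initSeg X n) (initSeg (fun i => X (n + i)) m) h3 fun κ hκ =>
        hmin κ (hκ.trans (initSeg_prefix _ (Nat.le_succ m))) (by
          rintro rfl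
          have := hκ.length_le
          simp at this)
      rw [initSeg_succ] at hm
      have hlast : F (initSeg X (n + (m + 1))) = ([], mulCode (F (initSeg X n)).2
          (c (initSeg (fun i => X (n + i)) m ++ [X (n + m)]))) := by
        rw [happ, initSeg_succ, ← List.append_assoc, hFc, hrun', hstep1 _ _ hm]
      refine ⟨n + (m + 1), by omega, by rw [hlast], ?_⟩
      rw [hlast, ratOfCode_mulCode, ← hcd, pow_succ]
      exact mul_le_mul h4 hm (by linarith) (hpos _)

end Martingales
-- Covers imply lowness
section CoverToLow
open scoped ENNReal
variable {A : Cantor}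

theorem realComputableIn_half (O : Set (ℕ →. ℕ)) : RealComputableIn O (1 / 2) :=
  ⟨fun _ => 1 / 2, ⟨fun _ => 1, fun _ => 0, fun _ => 2, ComputableIn.const _, ComputableIn.const _,
    ComputableIn.const _, fun _ => by norm_num⟩, fun a n => by norm_num⟩

theorem drop_initSeg (X : Cantor) (n k : ℕ) :
    (initSeg X k).drop n = initSeg (fun i => X (n + i)) (k - n) := by
  refine List.ext_getElem? fun i => ?_
  rw [List.getElem?_drop, getElem?_initSeg, getElem?_initSeg]
  exact if_congr (by omega) rfl rfl

theorem two_inv_pow_le_length {σ : List Bool} {U : Set (List Bool)} (hσ : σ ∈ U) {n : ℕ}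
    (h : lebesgue (openSet U) = 2⁻¹ ^ n) : n ≤ σ.length := by
  by_contra hlt
  have h1 : lebesgue (cyl σ) ≤ lebesgue (openSet U) :=
    measure_mono (Set.subset_biUnion_of_mem (u := cyl) hσ)
  rw [h, lebesgue_cyl] at h1
  have h2 := ENNReal.toReal_mono (by simp) h1
  rw [toReal_two_inv_pow, toReal_two_inv_pow] at h2
  exact absurd h2 (not_le.2 (pow_lt_pow_right_of_lt_one₀ (by norm_num) (by norm_num)
    (not_le.1 hlt)))

/-- A string generating the set of index `2 * i + 2` has at least that many letters, so deleting `i`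
of them multiplies its weight by exactly `2 ^ i`. The total for `i` is `2⁻¹ ^ (i + 2)`. -/
theorem tsum_weight_drop {W : ℕ → List Bool → Prop} (hpf : ∀ n, PrefixFree {σ | W n σ})
    (hW : ∀ n, lebesgue (openSet {σ | W n σ}) = 2⁻¹ ^ n) :
    ∑' x : {x : ℕ × List Bool // W (2 * x.1 + 2) x.2}, (2⁻¹ : ℝ≥0∞) ^ (x.1.2.drop x.1.1).length =
      1 / 2 := by
  rw [← (Equiv.subtypeProdEquivSigmaSubtype fun i σ => W (2 * i + 2) σ).symm.tsum_eq,
    ENNReal.tsum_sigma']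
  have h1 : ∀ i, ∑' σ : Subtype (W (2 * i + 2)), (2⁻¹ : ℝ≥0∞) ^
      (((Equiv.subtypeProdEquivSigmaSubtype fun i σ => W (2 * i + 2) σ).symm ⟨i, σ⟩).1.2.drop
      ((Equiv.subtypeProdEquivSigmaSubtype fun i σ => W (2 * i + 2) σ).symm ⟨i, σ⟩).1.1).length =
      2⁻¹ ^ i * 2⁻¹ ^ 2 := by
    intro i
    have h2 : ∀ σ : Subtype (W (2 * i + 2)), (2⁻¹ : ℝ≥0∞) ^
        (((Equiv.subtypeProdEquivSigmaSubtype fun i σ => W (2 * i + 2) σ).symm ⟨i, σ⟩).1.2.drop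
        ((Equiv.subtypeProdEquivSigmaSubtype fun i σ => W (2 * i + 2) σ).symm ⟨i, σ⟩).1.1).length =
        2 ^ i * 2⁻¹ ^ σ.1.length := by
      intro σ
      have h3 : 2 * i + 2 ≤ σ.1.length := two_inv_pow_le_length (U := {σ | W (2 * i + 2) σ}) σ.2 (hW _)
      change (2⁻¹ : ℝ≥0∞) ^ (σ.1.drop i).length = _
      obtain ⟨k, hk⟩ := Nat.exists_eq_add_of_le (show i ≤ σ.1.length by omega)
      rw [List.length_drop, hk, Nat.add_sub_cancel_left, pow_add, ← mul_assoc, ← mul_pow,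
        ENNReal.mul_inv_cancel (by simp) (by simp), one_pow, one_mul]
    rw [tsum_congr h2, ENNReal.tsum_mul_left]
    have h4 := hW (2 * i + 2)
    rw [(hpf _).lebesgue_openSet] at h4
    refine (congrArg (2 ^ i * ·) h4).trans ?_
    rw [two_mul, pow_add, pow_add, ← mul_assoc, ← mul_assoc, ← mul_pow,
      ENNReal.mul_inv_cancel (by simp) (by simp), one_pow, one_mul]
  rw [tsum_congr h1, ENNReal.tsum_mul_right, ENNReal.tsum_geometric, ENNReal.one_sub_inv_two,
    inv_inv, pow_two, ← mul_assoc, ENNReal.mul_inv_cancel (by simp) (by simp), one_mul, one_div]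

theorem succeeds_of_unbounded {d : List Bool → ℝ} {X : Cantor}
    (h : ∀ C : ℝ, ∀ N : ℕ, ∃ n, N ≤ n ∧ C ≤ d (initSeg X n)) : Succeeds d X := by
  refine EReal.eq_top_iff_forall_lt _ |>.2 fun C => ?_
  refine lt_of_lt_of_le (EReal.coe_lt_coe_iff.2 (lt_add_one C)) ?_
  refine le_limsup_of_frequently_le (Filter.frequently_atTop.2 fun N => ?_)
  obtain ⟨n, h1, h2⟩ := h (C + 1) N
  exact ⟨n, h1, EReal.coe_le_coe_iff.2 h2⟩

theorem mem_lowPair_of_covers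
    (h : ∀ V : Set Cantor, SchnorrOpenIn (oracle A) V → Bounded V →
      ∃ W : Set Cantor, WinningOpen W ∧ V ⊆ W) : A ∈ LowPair CR SR := by
  intro X hX T hT hmem
  obtain ⟨⟨W, hW, hWT⟩, -, hmeas⟩ := hT
  have hce : CE A fun x : ℕ × List Bool => (2 * x.1 + 2, x.2) ∈ W :=
    (CE.of_CEIn hW).comp (Primrec.pair (Primrec.nat_add.comp
      (Primrec.nat_mul.comp (Primrec.const 2) Primrec.fst) (Primrec.const 2)) Primrec.snd)
  obtain ⟨U, hU, hUce, hUsub, hUmeas⟩ := exists_prefixFree_half hce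
    (f := fun x => x.2.drop x.1) (Primrec.list_drop.comp Primrec.fst Primrec.snd)
    (tsum_weight_drop (W := fun n σ => (n, σ) ∈ W) (fun n => (hWT n).1)
      fun n => by rw [← (hWT n).2, hmeas]) le_rfl
    ((CE.of_primrec ((Primrec.nat_lt.comp (Primrec.const 0) Primrec.snd).and
      (Primrec.nat_lt.comp Primrec.snd
        (Primrec.nat_mul.comp (Primrec.const 2) Primrec.fst)))).of_eq fun p => by
      refine and_congr_right fun _ => ?_
      rw [one_div, mul_comm (2⁻¹ : ℝ≥0∞), ← div_eq_mul_inv, ENNReal.div_lt_iff (by simp) (by simp), mul_comm 2]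
      exact_mod_cast Iff.rfl)
  obtain ⟨_, ⟨_, ⟨d, q, hd, hd1, hdc, hq, rfl⟩, rfl⟩, hcov⟩ := h (openSet U)
    ⟨⟨U, hU, hUce.cein, rfl⟩, by
      rw [hUmeas, ENNReal.toReal_div]; exact realComputableIn_half _⟩
    (by rw [Bounded, hUmeas]; simp)
  obtain ⟨D, hD, hDc, hDX⟩ := exists_restart (isRatMartingale_iff.2 hd) (ratComp_iff.2 hdc) hd1 hq
  -- Membership of `X` in the test set of index `2 * n + 2` gives a prefix of `X` that, without its
  -- first `n` letters, is a prefix of the `n`-th tail.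
  have htail : ∀ n, (fun i => X (n + i)) ∈ openSet (minimalReaching d q) := by
    intro n
    have h1 := Set.mem_iInter.1 hmem (2 * n + 2)
    rw [(hWT _).2] at h1
    obtain ⟨k, hk⟩ := mem_openSet.1 h1
    refine hcov (hUsub (n, initSeg X k) hk ?_)
    rw [drop_initSeg, mem_cyl, length_initSeg]
  refine hX (fun σ => (D σ : ℝ)) (isRatMartingale_iff.1 hD)
    ⟨fun x => D x.1, ratComp_iff.1 (hDc.comp Computable.fst), fun a n => by simp⟩
    (succeeds_of_unbounded fun C N => ?_)
  obtain ⟨k, hk⟩ := pow_unbounded_of_one_lt C (show (1 : ℝ) < q by exact_mod_cast hq)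
  obtain ⟨n, h1, h2⟩ := hDX X htail (max N k)
  refine ⟨n, (le_max_left _ _).trans h1, hk.le.trans ?_⟩
  have h3 : q ^ k ≤ D (initSeg X n) :=
    (pow_le_pow_right₀ hq.le (le_max_right N k)).trans h2
  exact_mod_cast h3

end CoverToLow

/-! ### Lowness implies covers -/

section LowToCover
open scoped ENNReal
variable {A : Cantor}

/-- No positive computable martingale wins on all elements of `V`. -/
def Escapes (V : Set Cantor) : Prop :=
  ∀ d : List Bool → ℚ, IsRatMartingale d → RatComp d → (∀ σ, 0 < d σ) → ∀ q, d [] < q →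
    ∃ Y ∈ V, ∀ n, d (initSeg Y n) < q

theorem Escapes.mono {V V' : Set Cantor} (h : Escapes V) (hV : V ⊆ V') : Escapes V' := by
  intro d hd hc hpos q hq
  obtain ⟨Y, hY, h1⟩ := h d hd hc hpos q hq
  exact ⟨Y, hV hY, h1⟩

/-- If a martingale reached `q` on all of `V`, dividing it and `q` by `d [] > 0` would yield a
winning open set covering `V`. -/
theorem escapes_of_not_covered {V : Set Cantor}
    (h : ¬ ∃ W : Set Cantor, WinningOpen W ∧ V ⊆ W) : Escapes V := by
  intro d hd hc hpos q hq
  by_contra hcon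
  push Not at hcon
  have h0 := hpos []
  refine h ⟨_, ⟨_, ⟨fun σ => (d [])⁻¹ * d σ, (d [])⁻¹ * q,
    isRatMartingale_iff.1 (hd.const_mul (inv_nonneg.2 h0.le)), inv_mul_cancel₀ h0.ne',
    ratComp_iff.1 ((RatComp.const _).mul hc), ?_, rfl⟩, rfl⟩, fun Y hY => ?_⟩
  · rw [inv_mul_eq_div, lt_div_iff₀ h0, one_mul]
    exact hq
  · have hiff : ∀ σ, (d [])⁻¹ * q ≤ (d [])⁻¹ * d σ ↔ q ≤ d σ := fun σ =>
      mul_le_mul_iff_right₀ (inv_pos.2 h0)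
    have hex := hcon Y hY
    classical
    refine mem_openSet.2 ⟨Nat.find hex, (hiff _).2 (Nat.find_spec hex), fun τ hτ hne hle => ?_⟩
    obtain ⟨h1, h2⟩ := prefix_initSeg_iff.1 hτ
    refine Nat.find_min hex (m := τ.length) (lt_of_le_of_ne h1 fun he => hne ?_) ?_
    · rw [← h2, he]
    · rw [h2]
      exact (hiff τ).1 hle

/-- The sequence `σ` followed by `Y`. -/
def appendSeq (σ : List Bool) (Y : Cantor) : Cantor := fun i => (σ[i]?).getD (Y (i - σ.length))

theorem initSeg_appendSeq_add (σ : List Bool) (Y : Cantor) (j : ℕ) :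
    initSeg (appendSeq σ Y) (σ.length + j) = σ ++ initSeg Y j := by
  refine List.ext_getElem? fun i => ?_
  rw [getElem?_initSeg, List.getElem?_append, getElem?_initSeg]
  by_cases h : i < σ.length
  · rw [if_pos h, if_pos (by omega)]
    simp [appendSeq, List.getElem?_eq_getElem h]
  · rw [if_neg h]
    refine if_congr (by omega) ?_ rfl
    simp [appendSeq, List.getElem?_eq_none (not_lt.1 h)]

theorem initSeg_appendSeq_of_le (σ : List Bool) (Y : Cantor) {j : ℕ} (h : j ≤ σ.length) :
    initSeg (appendSeq σ Y) j = σ.take j := by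
  rw [← take_initSeg _ (h.trans (Nat.le_add_right σ.length 0)), initSeg_appendSeq_add]
  simp

/-- After a string `σ` of the `n`-th power along which `d` stays below `q`, the martingale `fun τ =>
d (σ ++ τ)` again starts below `q`, so the hypothesis on `U` applies to it. -/
theorem Escapes.concatPow {U : Set (List Bool)} (h : Escapes (openSet U)) (n : ℕ) :
    Escapes (openSet (concatPow U n)) := by
  induction n with
  | zero =>
    exact h.mono fun X _ => mem_openSet.2 ⟨0, rfl⟩
  | succ n ih =>
    intro d hd hc hpos q hq
    obtain ⟨Y, hY, h1⟩ := ih d hd hc hpos q hq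
    obtain ⟨k, hk⟩ := mem_openSet.1 hY
    set σ := initSeg Y k with hσ
    have hσl : σ.length = k := length_initSeg _ _
    obtain ⟨Z, hZ, h2⟩ := h (fun τ => d (σ ++ τ)) (hd.append σ) (hc.append σ)
      (fun τ => hpos _) q (by rw [List.append_nil]; exact h1 k)
    obtain ⟨m, hm⟩ := mem_openSet.1 hZ
    refine ⟨appendSeq σ Z, mem_openSet.2 ⟨σ.length + m, ?_⟩, fun j => ?_⟩
    · rw [initSeg_appendSeq_add]
      exact mem_concatPow_succ.2 ⟨σ, hk, _, hm, rfl⟩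
    · rcases le_total j σ.length with hj | hj
      · rw [initSeg_appendSeq_of_le _ _ hj, hσ, take_initSeg Y (hσl ▸ hj)]
        exact h1 j
      · obtain ⟨i, rfl⟩ := Nat.exists_eq_add_of_le hj
        rw [initSeg_appendSeq_add]
        exact h2 i

/-- `x < a / b` holds exactly when some approximation satisfies `g ((), j) + 2⁻¹ ^ j < a / b`.
Denominators are cleared and the subtracted term moved across to stay within `ℕ`. -/
theorem CE.real_lt_of_realComputableIn {x : ℝ} (hx : RealComputableIn (oracle A) x) :
    CE A fun p : ℕ × ℕ => 0 < p.2 ∧ x * p.2 < p.1 := by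
  obtain ⟨g, ⟨u, v, w, hu, hv, hw, hg⟩, happ⟩ := hx
  have h1 : ∀ {f : Unit × ℕ → ℕ}, ComputableIn (oracle A) f →
      CE A fun y : ℕ × ℕ => f ((), y.1) = y.2 := by
    intro f hf
    refine ((CE.graph hf).comp (Primrec.pair (Primrec.pair (Primrec.const ())
      Primrec.fst) Primrec.snd)).of_eq fun y => ?_
    rw [Part.mem_some_iff, eq_comm]
  have h2 : CE A fun p : ℕ × ℕ => ∃ t : ℕ × ℕ × ℕ × ℕ,
      (u ((), t.1) = t.2.1 ∧ v ((), t.1) = t.2.2.1 ∧ w ((), t.1) = t.2.2.2) ∧ 0 < p.2 ∧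
        (t.2.1 * 2 ^ t.1 + t.2.2.2) * p.2 <
          p.1 * (t.2.2.2 * 2 ^ t.1) + t.2.2.1 * 2 ^ t.1 * p.2 := by
    refine CE.exists (S := fun (p : ℕ × ℕ) (t : ℕ × ℕ × ℕ × ℕ) =>
      (u ((), t.1) = t.2.1 ∧ v ((), t.1) = t.2.2.1 ∧ w ((), t.1) = t.2.2.2) ∧ 0 < p.2 ∧
        (t.2.1 * 2 ^ t.1 + t.2.2.2) * p.2 <
          p.1 * (t.2.2.2 * 2 ^ t.1) + t.2.2.1 * 2 ^ t.1 * p.2) ?_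
    have ha : Primrec fun y : (ℕ × ℕ) × (ℕ × ℕ × ℕ × ℕ) => y.1.1 := Primrec.fst.comp Primrec.fst
    have hb : Primrec fun y : (ℕ × ℕ) × (ℕ × ℕ × ℕ × ℕ) => y.1.2 := Primrec.snd.comp Primrec.fst
    have hj : Primrec fun y : (ℕ × ℕ) × (ℕ × ℕ × ℕ × ℕ) => y.2.1 := Primrec.fst.comp Primrec.snd
    have hp : Primrec fun y : (ℕ × ℕ) × (ℕ × ℕ × ℕ × ℕ) => y.2.2.1 :=
      Primrec.fst.comp (Primrec.snd.comp Primrec.snd)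
    have hm : Primrec fun y : (ℕ × ℕ) × (ℕ × ℕ × ℕ × ℕ) => y.2.2.2.1 :=
      Primrec.fst.comp (Primrec.snd.comp (Primrec.snd.comp Primrec.snd))
    have hd : Primrec fun y : (ℕ × ℕ) × (ℕ × ℕ × ℕ × ℕ) => y.2.2.2.2 :=
      Primrec.snd.comp (Primrec.snd.comp (Primrec.snd.comp Primrec.snd))
    have hpow := primrec_pow.comp (Primrec.const 2) hj
    refine CE.and (((h1 hu).comp (hj.pair hp)).and (((h1 hv).comp (hj.pair hm)).and
      ((h1 hw).comp (hj.pair hd)))) (CE.of_primrec ((Primrec.nat_lt.comp (Primrec.const 0) hb).and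
        (Primrec.nat_lt.comp ?_ ?_)))
    · exact Primrec.nat_mul.comp (Primrec.nat_add.comp (Primrec.nat_mul.comp hp hpow) hd) hb
    · exact Primrec.nat_add.comp (Primrec.nat_mul.comp ha (Primrec.nat_mul.comp hd hpow))
        (Primrec.nat_mul.comp (Primrec.nat_mul.comp hm hpow) hb)
  refine h2.of_eq ?_
  rintro ⟨a, b⟩
  have key : ∀ j, 0 < b → ((u ((), j) * 2 ^ j + w ((), j)) * b <
      a * (w ((), j) * 2 ^ j) + v ((), j) * 2 ^ j * b ↔
        (g ((), j) : ℝ) + 2⁻¹ ^ j < a / b) := by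
    intro j hb
    have hb' : (0 : ℝ) < b := by exact_mod_cast hb
    have hw' : (0 : ℝ) < w ((), j) := by exact_mod_cast Nat.pos_of_ne_zero (hg ((), j)).1
    rw [(hg ((), j)).2, ← Nat.cast_lt (α := ℝ), lt_div_iff₀ hb']
    push_cast
    have hz : (0 : ℝ) < w ((), j) * 2 ^ j := by positivity
    rw [inv_pow]
    refine Iff.trans ?_ (mul_lt_mul_iff_left₀ hz)
    have h3 : (((u ((), j) : ℝ) - v ((), j)) / w ((), j) + (2 ^ j)⁻¹) * b *
        (w ((), j) * 2 ^ j) = (u ((), j) * 2 ^ j + w ((), j)) * b - v ((), j) * 2 ^ j * b := by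
      field_simp
      ring
    rw [h3, sub_lt_iff_lt_add]
  constructor
  · rintro ⟨⟨j, t, m, z⟩, ⟨ht, hm, hz⟩, hb, h⟩
    dsimp only at ht hm hz hb h
    subst ht hm hz
    refine ⟨hb, ?_⟩
    rw [← lt_div_iff₀ (by exact_mod_cast hb)]
    have h3 := (key j hb).1 h
    have h4 := abs_le.1 (happ () j)
    linarith [h4.1]
  · rintro ⟨hb, h⟩
    dsimp only at hb h
    rw [← lt_div_iff₀ (by exact_mod_cast hb)] at h
    obtain ⟨j, hj⟩ := exists_pow_lt_of_lt_one (show (0 : ℝ) < (a / b - x) / 2 by linarith)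
      (show (2⁻¹ : ℝ) < 1 by norm_num)
    refine ⟨⟨j, _, _, _⟩, ⟨rfl, rfl, rfl⟩, hb, (key j hb).2 ?_⟩
    have h4 := abs_le.1 (happ () j)
    linarith [h4.2]

/-- By continuity, `x ^ k < a / b` is witnessed by a rational above `x` whose `k`-th power is still
below `a / b`. -/
theorem CE.pow_real_lt {x : ℝ} (hx0 : 0 ≤ x)
    (hx : CE A fun p : ℕ × ℕ => 0 < p.2 ∧ x * p.2 < p.1) (k : ℕ) :
    CE A fun p : ℕ × ℕ => 0 < p.2 ∧ x ^ k * p.2 < p.1 := by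
  have h1 : CE A fun p : ℕ × ℕ => ∃ t : ℕ × ℕ, (0 < t.2 ∧ x * t.2 < t.1) ∧
      0 < p.2 ∧ t.1 ^ k * p.2 < p.1 * t.2 ^ k := by
    refine CE.exists (S := fun (p t : ℕ × ℕ) => (0 < t.2 ∧ x * t.2 < t.1) ∧
      0 < p.2 ∧ t.1 ^ k * p.2 < p.1 * t.2 ^ k) ((hx.comp Primrec.snd).and (CE.of_primrec
        ((Primrec.nat_lt.comp (Primrec.const 0) (Primrec.snd.comp Primrec.fst)).and
          (Primrec.nat_lt.comp (Primrec.nat_mul.comp (primrec_pow.comp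
            (Primrec.fst.comp Primrec.snd) (Primrec.const k)) (Primrec.snd.comp Primrec.fst))
            (Primrec.nat_mul.comp (Primrec.fst.comp Primrec.fst) (primrec_pow.comp
            (Primrec.snd.comp Primrec.snd) (Primrec.const k)))))))
  refine h1.of_eq ?_
  rintro ⟨a, b⟩
  constructor
  · rintro ⟨⟨s, t⟩, ⟨ht, hst⟩, hb, h⟩
    dsimp only at *
    refine ⟨hb, ?_⟩
    have ht' : (0 : ℝ) < t := by exact_mod_cast ht
    rw [← lt_div_iff₀ ht'] at hst
    have h2 : ((s : ℝ) / t) ^ k * b < a := by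
      rw [div_pow, div_mul_eq_mul_div, div_lt_iff₀ (by positivity)]
      exact_mod_cast h
    exact lt_of_le_of_lt (by gcongr) h2
  · rintro ⟨hb, h⟩
    dsimp only at hb h
    have hb' : (0 : ℝ) < b := by exact_mod_cast hb
    have hcont : Tendsto (fun y : ℝ => y ^ k * b) (nhdsWithin x (Set.Ioi x)) (nhds (x ^ k * b)) :=
      ((continuous_id.pow k).mul continuous_const).continuousWithinAt
    obtain ⟨y, hy, hxy⟩ := ((hcont.eventually (gt_mem_nhds h)).and self_mem_nhdsWithin).exists
    obtain ⟨r, hr1, hr2⟩ := exists_rat_btwn (show x < y from hxy)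
    have hr0 : 0 < r := by
      have : (0 : ℝ) < r := lt_of_le_of_lt hx0 hr1
      exact_mod_cast this
    have hden : (0 : ℝ) < r.den := by exact_mod_cast r.den_pos
    have hrnum := ratCast_eq_toNat_div hr0
    refine ⟨(r.num.toNat, r.den), ⟨r.den_pos, ?_⟩, hb, ?_⟩
    · dsimp only
      rwa [← lt_div_iff₀ hden, ← hrnum]
    · have h2 : ((r.num.toNat : ℝ) / r.den) ^ k * b < a := by
        rw [← hrnum]
        refine lt_of_le_of_lt ?_ hy
        have : (0 : ℝ) ≤ r := by exact_mod_cast hr0.le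
        gcongr
      rw [div_pow, div_mul_eq_mul_div, div_lt_iff₀ (by positivity)] at h2
      dsimp only
      exact_mod_cast h2

/-- If `V` is a bounded `A`-Schnorr open set on which no martingale wins, then there is a prefix-free
`A`-c.e. set generating an open set of measure one half with the same property. -/
theorem exists_escapes_half {V : Set Cantor} (hV : SchnorrOpenIn (oracle A) V) (hb : Bounded V)
    (hesc : Escapes V) :
    ∃ U : Set (List Bool), PrefixFree U ∧ CE A (fun σ => σ ∈ U) ∧ Escapes (openSet U) ∧
      lebesgue (openSet U) = 2⁻¹ := by
  obtain ⟨⟨U, hU, hUce, rfl⟩, hreal⟩ := hV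
  -- Padding can only enlarge, so a power of measure below `1 / 2` is taken first; boundedness of
  -- `V` provides it.
  obtain ⟨k, hk⟩ : ∃ k : ℕ, lebesgue (openSet U) ^ k < 1 / 2 :=
    ((ENNReal.tendsto_pow_atTop_nhds_zero_of_lt_one hb).eventually
      (gt_mem_nhds (by simp))).exists
  have hce : CE A fun σ => σ ∈ concatPow U k :=
    (CE.concatPow (CE.of_CEIn hUce)).comp ((Primrec.const k).pair Primrec.id)
  have hS := (hU.concatPow k).lebesgue_openSet
  rw [hU.lebesgue_concatPow] at hS
  obtain ⟨U', h1, h2, h3, h4⟩ := exists_prefixFree_half hce (f := id) Primrec.id hS.symm hk.le <| by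
    refine (CE.pow_real_lt ENNReal.toReal_nonneg (CE.real_lt_of_realComputableIn hreal) k).of_eq
      fun p => and_congr_right fun _ => ?_
    rw [← ENNReal.toReal_lt_toReal (ENNReal.mul_ne_top (by simp) (by simp)) (by simp)]
    simp [ENNReal.toReal_mul, ENNReal.toReal_pow]
  refine ⟨U', h1, h2, (hesc.concatPow k).mono ?_, by rw [h4, one_div]⟩
  exact Set.iUnion₂_subset fun σ hσ => h3 σ hσ

/-- Only finitely many strict inequalities are involved, and each persists for small `c` by
continuity at `0`. -/
theorem exists_pos_mixture {D e : List Bool → ℚ} {σ : List Bool}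
    (h : ∀ τ, τ <+: σ → D τ < 2) : ∃ c : ℚ, 0 < c ∧ ∀ τ, τ <+: σ → D τ + c * e τ < 2 := by
  have h1 : ∀ k ∈ Finset.range (σ.length + 1), ∀ᶠ c : ℚ in nhdsWithin 0 (Set.Ioi 0),
      D (σ.take k) + c * e (σ.take k) < 2 := by
    intro k _
    have h2 : Tendsto (fun c : ℚ => D (σ.take k) + c * e (σ.take k))
        (nhdsWithin 0 (Set.Ioi 0)) (nhds (D (σ.take k) + 0 * e (σ.take k))) :=
      (continuous_const.add (continuous_id.mul continuous_const)).continuousWithinAt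
    exact h2.eventually (gt_mem_nhds (by simpa using h _ (List.take_prefix _ _)))
  obtain ⟨c, hc, hc0⟩ := (((Filter.eventually_all_finset _).2 h1).and self_mem_nhdsWithin).exists
  refine ⟨c, hc0, fun τ hτ => ?_⟩
  have := hc τ.length (Finset.mem_range.2 (Nat.lt_succ_of_le hτ.length_le))
  rwa [← List.prefix_iff_eq_take.1 hτ] at this

/-- The states of the construction of a computably random sequence in the sets `[Uⁿ]`: a string and
a mixture of martingales that stays below two along it. -/
def IsState (s : List Bool × (List Bool → ℚ)) : Prop :=
  IsRatMartingale s.2 ∧ RatComp s.2 ∧ (∀ σ, 1 ≤ s.2 σ) ∧ ∀ τ, τ <+: s.1 → s.2 τ < 2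

theorem IsState.exists_next {U : Set (List Bool)} (hU : Escapes (openSet U))
    {s : List Bool × (List Bool → ℚ)} (hs : IsState s) {e : List Bool → ℚ}
    (he : IsRatMartingale e) (hec : RatComp e) :
    ∃ s' : List Bool × (List Bool → ℚ), IsState s' ∧ (∃ τ ∈ U, s'.1 = s.1 ++ τ) ∧
      ∃ c : ℚ, 0 < c ∧ ∀ ρ, s'.2 ρ = s.2 ρ + c * e ρ := by
  obtain ⟨σ, D⟩ := s
  obtain ⟨hD, hDc, hD1, hD2⟩ := hs
  dsimp only at *
  obtain ⟨c, hc0, hc⟩ := exists_pos_mixture (e := e) hD2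
  have hM : IsRatMartingale fun ρ => D ρ + c * e ρ := hD.add (he.const_mul hc0.le)
  have hMc : RatComp fun ρ => D ρ + c * e ρ := hDc.add ((RatComp.const c).mul hec)
  have hM1 : ∀ ρ, 1 ≤ D ρ + c * e ρ := fun ρ =>
    (hD1 ρ).trans (le_add_of_nonneg_right (mul_nonneg hc0.le (he.1 ρ)))
  -- The lower bound `1` on the mixture supplies the positivity that `Escapes` asks for.
  obtain ⟨Y, hY, hlt⟩ := hU _ (hM.append σ) (hMc.append σ)
    (fun ρ => zero_lt_one.trans_le (hM1 _)) 2 (by simpa using hc σ List.prefix_rfl)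
  obtain ⟨k, hk⟩ := mem_openSet.1 hY
  refine ⟨(σ ++ initSeg Y k, fun ρ => D ρ + c * e ρ), ⟨hM, hMc, hM1, fun τ hτ => ?_⟩,
    ⟨_, hk, rfl⟩, c, hc0, fun ρ => rfl⟩
  rcases List.prefix_or_prefix_of_prefix hτ (List.prefix_append σ (initSeg Y k)) with h | h
  · exact hc τ h
  · obtain ⟨κ, rfl⟩ := h
    have h1 := (prefix_initSeg_iff.1 ((List.prefix_append_right_inj σ).1 hτ)).2
    have h2 := hlt κ.length
    rwa [h1] at h2

theorem exists_limit_of_prefix_chain {σ : ℕ → List Bool} (h : ∀ n, σ n <+: σ (n + 1))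
    (hlen : ∀ n, n ≤ (σ n).length) : ∃ X : Cantor, ∀ n, initSeg X (σ n).length = σ n := by
  have hmono : ∀ m n, m ≤ n → σ m <+: σ n := fun m n hmn => by
    induction n, hmn using Nat.le_induction with
    | base => exact List.prefix_rfl
    | succ n _ ih => exact ih.trans (h n)
  have hget : ∀ m n i, m ≤ n → i < (σ m).length → (σ n)[i]? = (σ m)[i]? := by
    intro m n i hmn hi
    obtain ⟨u, hu⟩ := hmono m n hmn
    rw [← hu, List.getElem?_append_left hi]
  -- `σ (i + 1)` has more than `i` letters, so the default `false` is never used.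
  refine ⟨fun i => ((σ (i + 1))[i]?).getD false, fun n => List.ext_getElem? fun i => ?_⟩
  rw [getElem?_initSeg]
  split_ifs with hi
  · have h1 : i < (σ (i + 1)).length := hlen (i + 1)
    have h2 : (σ (i + 1))[i]? = (σ n)[i]? := by
      rcases le_total n (i + 1) with h3 | h3
      · exact hget _ _ _ h3 hi
      · exact (hget _ _ _ h3 h1).symm
    rw [h2, List.getElem?_eq_getElem hi, Option.getD_some]
  · rw [List.getElem?_eq_none (not_lt.1 hi)]

theorem not_succeeds_of_bounded {d : List Bool → ℝ} {X : Cantor} {C : ℝ}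
    (h : ∀ n, d (initSeg X n) ≤ C) : ¬ Succeeds d X := by
  intro hs
  have h1 : limsup (fun n => ((d (initSeg X n) : ℝ) : EReal)) atTop ≤ (C : EReal) :=
    limsup_le_of_le (h := Eventually.of_forall fun n => EReal.coe_le_coe_iff.2 (h n))
  rw [hs] at h1
  exact absurd h1 (not_le.2 (EReal.coe_lt_top C))

/-- If no martingale wins on `[U]`, then some computably random sequence lies in all `[Uⁿ]`. -/
theorem Escapes.exists_mem_CR {U : Set (List Bool)} (hU : Escapes (openSet U)) (hnil : [] ∉ U) :
    ∃ X ∈ CR, ∀ n, X ∈ openSet (OpenCovers.concatPow U n) := by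
  have hone : IsRatMartingale fun _ => 1 := ⟨fun _ => zero_le_one, fun _ => by norm_num⟩
  -- The enumeration need not be effective: each mixture is a finite sum and so computable, while
  -- `X` itself need not be.
  obtain ⟨e, he⟩ : ∃ e : ℕ → List Bool → ℚ,
      {f : List Bool → ℚ | RatComp f ∧ IsRatMartingale f} = Set.range e :=
    (countable_setOf_ratComp.mono fun f hf => hf.1).exists_eq_range ⟨_, RatComp.const 1, hone⟩
  have hmem : ∀ n, RatComp (e n) ∧ IsRatMartingale (e n) := fun n =>
    (Set.ext_iff.1 he (e n)).2 ⟨n, rfl⟩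
  have hstart : IsState ([], fun _ => 1) :=
    ⟨hone, RatComp.const 1, fun _ => le_rfl, fun _ _ => by norm_num⟩
  have hnext : ∀ (n : ℕ) (s : {s // IsState s}), ∃ s' : {s // IsState s},
      (∃ τ ∈ U, s'.1.1 = s.1.1 ++ τ) ∧ ∃ c : ℚ, 0 < c ∧ ∀ ρ, s'.1.2 ρ = s.1.2 ρ + c * e n ρ := by
    intro n s
    obtain ⟨s', h1, h2⟩ := s.2.exists_next hU (hmem n).2 (hmem n).1
    exact ⟨⟨s', h1⟩, h2⟩
  choose next hnext1 hnext2 using hnext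
  let s : ℕ → {s // IsState s} := fun n => Nat.rec ⟨_, hstart⟩ next n
  have hs : ∀ n, s (n + 1) = next n (s n) := fun n => rfl
  have hpow : ∀ n, (s n).1.1 ∈ OpenCovers.concatPow U n := by
    intro n
    induction n with
    | zero => rfl
    | succ n ih =>
      obtain ⟨τ, hτ, h⟩ := hnext1 n (s n)
      exact mem_concatPow_succ.2 ⟨_, ih, τ, hτ, by rw [hs, h]⟩
  have hchain : ∀ n, (s n).1.1 <+: (s (n + 1)).1.1 := by
    intro n
    obtain ⟨τ, -, h⟩ := hnext1 n (s n)
    rw [hs, h]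
    exact List.prefix_append _ _
  have hlen : ∀ n, n ≤ (s n).1.1.length := by
    intro n
    induction n with
    | zero => exact Nat.zero_le _
    | succ n ih =>
      obtain ⟨τ, hτ, h⟩ := hnext1 n (s n)
      have h0 : 0 < τ.length := List.length_pos_of_ne_nil fun h0 => hnil (h0 ▸ hτ)
      rw [hs, h, List.length_append]
      omega
  obtain ⟨X, hX⟩ := exists_limit_of_prefix_chain hchain hlen
  have hDmono : ∀ ρ, Monotone fun n => (s n).1.2 ρ := fun ρ => by
    refine monotone_nat_of_le_succ fun n => ?_
    obtain ⟨c, hc, h⟩ := hnext2 n (s n)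
    rw [hs, h]
    exact le_add_of_nonneg_right (mul_nonneg hc.le ((hmem n).2.1 ρ))
  -- Mixtures only grow, so it suffices to look at a later stage whose string already extends
  -- `initSeg X k`.
  have hlt : ∀ n k, (s n).1.2 (initSeg X k) < 2 := by
    intro n k
    refine lt_of_le_of_lt (hDmono _ (le_max_left n k)) ((s (max n k)).2.2.2.2 _ ?_)
    rw [← hX]
    exact initSeg_prefix X ((le_max_right n k).trans (hlen _))
  refine ⟨X, fun d hd hdc => ?_, fun n => mem_openSet.2 ⟨_, (hX n).symm ▸ hpow n⟩⟩
  obtain ⟨B, hB, hBc, hdB⟩ := exists_ratMartingale_ge hd hdc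
  obtain ⟨n, rfl⟩ := (Set.ext_iff.1 he B).1 ⟨hBc, hB⟩
  obtain ⟨c, hc, h⟩ := hnext2 n (s n)
  -- The dominating martingale `e n` entered the mixture with coefficient `c`, and the mixture stays
  -- below `2` along `X`.
  refine not_succeeds_of_bounded (C := ((2 / c : ℚ) : ℝ)) fun k => (hdB _).trans ?_
  rw [Rat.cast_le, le_div_iff₀ hc, mul_comm]
  have h1 := hlt (n + 1) k
  rw [hs, h] at h1
  have h2 := (s n).2.1.1 (initSeg X k)
  linarith

theorem covers_of_mem_lowPair (hA : A ∈ LowPair CR SR) {V : Set Cantor}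
    (hV : SchnorrOpenIn (oracle A) V) (hb : Bounded V) :
    ∃ W : Set Cantor, WinningOpen W ∧ V ⊆ W := by
  by_contra hcon
  obtain ⟨U, hU, hUce, hesc, hmeas⟩ := exists_escapes_half hV hb (escapes_of_not_covered hcon)
  have hnil : [] ∉ U := by
    intro h
    have h1 : openSet U = Set.univ := Set.eq_univ_of_forall fun X => mem_openSet.2 ⟨0, h⟩
    rw [h1, measure_univ] at hmeas
    exact absurd hmeas.symm (by simp)
  obtain ⟨X, hX, hXU⟩ := hesc.exists_mem_CR hnil
  refine hA hX (fun n => openSet (concatPow U n)) ⟨⟨{p | p.2 ∈ concatPow U p.1},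
    CE.cein (CE.concatPow hUce), fun n => ⟨hU.concatPow n, rfl⟩⟩, openSet_concatPow_antitone U,
    fun n => ?_⟩ (Set.mem_iInter.2 hXU)
  rw [hU.lebesgue_concatPow, hmeas]

end LowToCover
end OpenCovers

theorem mainTheorem8 (A : OpenCovers.Cantor) :
    A ∈ OpenCovers.LowPair OpenCovers.CR OpenCovers.SR ↔
      ∀ V : Set OpenCovers.Cantor,
        OpenCovers.SchnorrOpenIn (OpenCovers.oracle A) V → OpenCovers.Bounded V →
          ∃ W : Set OpenCovers.Cantor, OpenCovers.WinningOpen W ∧ V ⊆ W :=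
  ⟨fun hA _ hV hb => OpenCovers.covers_of_mem_lowPair hA hV hb, OpenCovers.mem_lowPair_of_covers⟩
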